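/- Let $\mathfrak q$ be a finite-dimensional Lie algebra over a field $\Bbbk$ of characteristic zero. For $\alpha\in\mathfrak q^*$ let $\mathfrak q_\alpha=\{x\in\mathfrak q\mid \alpha([x,\mathfrak q])=0\}$, let $d\alpha\in\bigwedge^2\mathfrak q^*$ be the Chevalley–Eilenberg differential of $\alpha$, given by $d\alpha(x,y)=-\alpha([x,y])$, and let $\mathrm{ad}^*(\mathfrak q)\cdot\alpha=\{-\alpha\circ\mathrm{ad}(x)\mid x\in\mathfrak q\}$. The index of $\mathfrak q$ is $\mathrm{ind}\,\mathfrak q=\min_{\gamma\in\mathfrak q^*}\dim\mathfrak q_\gamma$. The Lie algebra $\mathfrak q$ is called contact if $\dim\mathfrak q=2n+1$ for some integer $n\ge 0$ and $(d\alpha)^{\wedge n}\wedge\alpha\neq 0$ for some $\alpha\in\mathfrak q^*$. A property holds for generic $\alpha\in\mathfrak q^*$ if it holds for all $\alpha$ in some non-empty Zariski open subset of $\mathfrak q^*$; a property holds for a generic orbit in $\mathfrak q^*$ if it holds for every orbit meeting some non-empty Zariski open subset of $\mathfrak q^*$. Suppose that $\mathrm{ind}\,\mathfrak q=1$. (i)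 $\mathfrak q$ is contact if and only if $\alpha\notin\mathrm{ad}^*(\mathfrak q)\cdot\alpha$ for generic $\alpha\in\mathfrak q^*$. (ii) Suppose in addition that $\Bbbk$ is algebraically closed and that $\mathfrak q=\mathrm{Lie}\,Q$ for an affine algebraic group $Q$ over $\Bbbk$ (not necessarily connected). Then $\alpha\notin\mathrm{ad}^*(\mathfrak q)\cdot\alpha$ for generic $\alpha\in\mathfrak q^*$ if and only if a generic orbit of the coadjoint action of $Q$ on $\mathfrak q^*$ is not conical, where the orbit $Q\alpha$ is called conical if $\Bbbk^{\times}\alpha\subset Q\alpha$. -/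

import Mathlib

open scoped TensorProduct

noncomputable section

namespace ContactLie

/-! ### Zariski-generic points of a vector space -/

section Generic

variable (k : Type*) [Field k] {V : Type*} [AddCommGroup V] [Module k V]

/-- Zariski open subsets of a vector space `V`: sets of points where some member of a family of
polynomial functions does not vanish. A polynomial function on `V` is a polynomial expression in
linear functionals on `V`. -/
def IsZariskiOpen (U : Set V) : Prop :=
  ∃ S : Set (MvPolynomial (Module.Dual k V) k),
    U = {v | ∃ f ∈ S, MvPolynomial.eval (fun φ : Module.Dual k V => φ v) f ≠ 0}

/-- `P` holds for generic points of `V`: for all points of some nonempty Zariski open subset. -/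
def Generically (P : V → Prop) : Prop :=
  ∃ U : Set V, IsZariskiOpen k U ∧ U.Nonempty ∧ ∀ v ∈ U, P v

end Generic

/-! ### Stabilisers, index and contact forms -/

section Lie

variable (k : Type*) [Field k] {q : Type*} [LieRing q] [LieAlgebra k q]

/-- The stabiliser `q_α = {x | α([x, q]) = 0}` of `α ∈ q*`. -/
def stabiliser (α : Module.Dual k q) : Submodule k q where
  carrier := {x | ∀ y : q, α ⁅x, y⁆ = 0}
  add_mem' hx hy z := by simp [hx z, hy z]
  zero_mem' z := by simp
  smul_mem' c x hx z := by simp [hx z]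

variable (q) in
/-- The index of `q`: the minimum over `γ ∈ q*` of `dim q_γ`. -/
def index : ℕ :=
  sInf (Set.range fun γ : Module.Dual k q => Module.finrank k (stabiliser k γ))

/-- The tangent space `ad*(q)·α` of the coadjoint action at `α`; here `⁅x, α⁆` is the coadjoint
action of `x` on `α`, i.e. `⁅x, α⁆ y = -α ⁅x, y⁆`. -/
def adStar (α : Module.Dual k q) : Set (Module.Dual k q) :=
  Set.range fun x : q => (⁅x, α⁆ : Module.Dual k q)

variable [FiniteDimensional k q]

/-- The Chevalley–Eilenberg differential `dα ∈ ⋀² q*` of `α ∈ q*`. In terms of a basis `e_i` of `q`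
and the dual basis `e^i`, it is `-(1/2) ∑ α([e_i, e_j]) e^i ∧ e^j`. See `pairing_ceDifferential`
for its characterisation `dα(x, y) = -α([x, y])`. -/
def ceDifferential (α : Module.Dual k q) : ⋀[k]^2 (Module.Dual k q) :=
  ∑ i, ∑ j, (-(1 / 2 : k) * α ⁅Module.finBasis k q i, Module.finBasis k q j⁆) •
    exteriorPower.ιMulti k 2
      ![(Module.finBasis k q).coord i, (Module.finBasis k q).coord j]

theorem pairing_ceDifferential [CharZero k] (α : Module.Dual k q) (x y : q) :
    exteriorPower.pairingDual k q 2 (ceDifferential k α) (exteriorPower.ιMulti k 2 ![x, y]) =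
      -α ⁅x, y⁆ := by
  set b := Module.finBasis k q with hb
  have expand : ∀ u v : q, α ⁅u, v⁆ = ∑ i, ∑ j, b.coord i u * (b.coord j v * α ⁅b i, b j⁆) := by
    intro u v
    have h : ⁅u, v⁆ = ⁅∑ i, b.repr u i • b i, ∑ j, b.repr v j • b j⁆ := by
      rw [b.sum_repr, b.sum_repr]
    rw [h, sum_lie, map_sum]
    refine Finset.sum_congr rfl fun i _ => ?_
    rw [lie_sum, map_sum]
    refine Finset.sum_congr rfl fun j _ => ?_
    simp
    ring
  have h1 := expand x y
  have h2 := expand y x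
  rw [← lie_skew, map_neg] at h2
  have h3 : -α ⁅x, y⁆ = -(1 / 2 : k) * (α ⁅x, y⁆ - -α ⁅x, y⁆) := by ring
  rw [h3, h2, h1, ← Finset.sum_sub_distrib, Finset.mul_sum]
  simp only [ceDifferential, map_sum, map_smul, LinearMap.sum_apply, LinearMap.smul_apply,
    exteriorPower.pairingDual_ιMulti_ιMulti, Matrix.det_fin_two, smul_eq_mul]
  refine Finset.sum_congr rfl fun i _ => ?_
  rw [← Finset.sum_sub_distrib, Finset.mul_sum]
  refine Finset.sum_congr rfl fun j _ => ?_
  simp [← hb]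
  ring

variable (q) in
/-- `q` is contact: `dim q = 2n+1` and `(dα)^n ∧ α ≠ 0` for some `α ∈ q*`. -/
def IsContact : Prop :=
  ∃ n : ℕ, Module.finrank k q = 2 * n + 1 ∧ ∃ α : Module.Dual k q,
    (ceDifferential k α : ExteriorAlgebra k (Module.Dual k q)) ^ n * ExteriorAlgebra.ι k α ≠ 0

end Lie

/-! ### Affine algebraic groups

An affine algebraic group `Q` over `k` is given by its coordinate ring `A = k[Q]`, a commutative
Hopf algebra over `k`, finitely generated as an algebra. -/

section Group

variable (k : Type*) [Field k] (A : Type*) [CommRing A] [HopfAlgebra k A]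

/-- The group `Q(k)` of `k`-points of `Q`: algebra homomorphisms `k[Q] → k` under convolution. -/
abbrev Points : Type _ := WithConv (A →ₐ[k] k)

/-- The Lie algebra `Lie Q`: the derivations `D` of `k[Q]` which are left invariant, i.e.
`Δ ∘ D = (id ⊗ D) ∘ Δ`, with the commutator bracket. -/
def lieAlg : LieSubalgebra k (Derivation k A A) where
  carrier := {D | ∀ a : A, Coalgebra.comul (R := k) (D a) =
    (D : A →ₗ[k] A).lTensor A (Coalgebra.comul a)}
  add_mem' {D E} hD hE a := by
    simp [LinearMap.lTensor_add, hD a, hE a]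
  zero_mem' a := by simp
  smul_mem' c D hD a := by
    simp [LinearMap.lTensor_smul, hD a]
  lie_mem' {D E} hD hE a := by
    rw [Derivation.commutator_apply, map_sub, hD (E a), hE a, hE (D a), hD a,
      Derivation.commutator_coe_linear_map, Ring.lie_def, LinearMap.lTensor_sub,
      LinearMap.lTensor_mul, LinearMap.lTensor_mul, LinearMap.sub_apply, Module.End.mul_apply,
      Module.End.mul_apply]

variable {k A}

/-- Right translation of functions by `g ∈ Q(k)`, `(ρ_g f)(x) = f(xg)`. -/
def rightTranslation (g : Points k A) : A →ₐ[k] A :=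
  (WithConv.toConv (AlgHom.id k A) *
    WithConv.toConv ((Algebra.ofId k A).comp g.ofConv)).ofConv

theorem rightTranslation_one : rightTranslation (1 : Points k A) = AlgHom.id k A := by
  have h : WithConv.toConv ((Algebra.ofId k A).comp (1 : Points k A).ofConv) = 1 := by
    ext a
    simp [AlgHom.convOne_def, Algebra.ofId_apply]
  rw [rightTranslation, h, mul_one]

theorem rightTranslation_mul (g h : Points k A) :
    rightTranslation (g * h) = (rightTranslation g).comp (rightTranslation h) := by
  have e : (rightTranslation g).comp ((Algebra.ofId k A).comp h.ofConv) =
      (Algebra.ofId k A).comp h.ofConv := by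
    ext a
    simp [Algebra.ofId_apply]
  rw [rightTranslation.eq_def h, AlgHom.comp_convMul_distrib, WithConv.ofConv_toConv,
    WithConv.ofConv_toConv, e, AlgHom.comp_id, rightTranslation, rightTranslation,
    AlgHom.comp_convMul_distrib, WithConv.toConv_ofConv, WithConv.toConv_ofConv, mul_assoc]

theorem comul_rightTranslation (g : Points k A) (a : A) :
    Coalgebra.comul (R := k) (rightTranslation g a) =
      (rightTranslation g).toLinearMap.lTensor A (Coalgebra.comul a) := by
  have hc : Bialgebra.comulAlgHom k A = (WithConv.toConv
      (Algebra.TensorProduct.includeLeft : A →ₐ[k] A ⊗[k] A) *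
      WithConv.toConv Algebra.TensorProduct.includeRight).ofConv := by
    have h : (Algebra.TensorProduct.lmul' k).comp (Algebra.TensorProduct.map
        (Algebra.TensorProduct.includeLeft : A →ₐ[k] A ⊗[k] A)
        Algebra.TensorProduct.includeRight) = AlgHom.id k (A ⊗[k] A) := by
      ext <;> simp
    rw [AlgHom.convMul_def, WithConv.ofConv_toConv, WithConv.ofConv_toConv,
      WithConv.ofConv_toConv, ← AlgHom.comp_assoc, h, AlgHom.id_comp]
  have h : (Bialgebra.comulAlgHom k A).comp (rightTranslation g) =
      (Algebra.TensorProduct.map (AlgHom.id k A) (rightTranslation g)).comp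
        (Bialgebra.comulAlgHom k A) := by
    conv_rhs => rw [hc, AlgHom.comp_convMul_distrib]
    have h1 : (Algebra.TensorProduct.map (AlgHom.id k A) (rightTranslation g)).comp
        Algebra.TensorProduct.includeLeft =
          (Algebra.TensorProduct.includeLeft : A →ₐ[k] A ⊗[k] A) := by
      ext; simp
    have h2 : (Algebra.TensorProduct.map (AlgHom.id k A) (rightTranslation g)).comp
        Algebra.TensorProduct.includeRight =
          (Algebra.TensorProduct.includeRight : A →ₐ[k] A ⊗[k] A).comp
            (rightTranslation g) := by
      ext; simp
    have h3 : (Bialgebra.comulAlgHom k A).comp ((Algebra.ofId k A).comp g.ofConv) =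
        (Algebra.TensorProduct.includeRight : A →ₐ[k] A ⊗[k] A).comp
          ((Algebra.ofId k A).comp g.ofConv) := by
      ext a
      simp [Algebra.ofId_apply]
    simp only
    rw [h1, h2, rightTranslation, AlgHom.comp_convMul_distrib, AlgHom.comp_convMul_distrib]
    simp only [AlgHom.comp_id, WithConv.toConv_ofConv]
    rw [h3, ← mul_assoc]
    congr 3
  exact DFunLike.congr_fun h a

theorem rightTranslation_inv_apply (g : Points k A) (a : A) :
    rightTranslation g (rightTranslation g⁻¹ a) = a := by
  rw [← AlgHom.comp_apply, ← rightTranslation_mul, mul_inv_cancel, rightTranslation_one]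
  rfl

/-- The derivation `ρ_g ∘ D ∘ ρ_g⁻¹` of `k[Q]`. -/
def conjDerivation (g : Points k A) (D : Derivation k A A) : Derivation k A A :=
  Derivation.mk' ((rightTranslation g).toLinearMap ∘ₗ (D : A →ₗ[k] A) ∘ₗ
    (rightTranslation g⁻¹).toLinearMap) fun a b => by
      simp [rightTranslation_inv_apply]

theorem conjDerivation_apply (g : Points k A) (D : Derivation k A A) (a : A) :
    conjDerivation g D a = rightTranslation g (D (rightTranslation g⁻¹ a)) := rfl

theorem conjDerivation_mem (g : Points k A) {D : Derivation k A A} (hD : D ∈ lieAlg k A) :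
    conjDerivation g D ∈ lieAlg k A := by
  intro a
  rw [conjDerivation_apply, comul_rightTranslation, hD, comul_rightTranslation]
  rw [← LinearMap.comp_apply, ← LinearMap.comp_apply, ← LinearMap.lTensor_comp,
    ← LinearMap.lTensor_comp]
  rfl

variable (k A) in
/-- The adjoint representation of `Q(k)` on `Lie Q`: `Ad(g) D = ρ_g ∘ D ∘ ρ_g⁻¹`. -/
def Ad : Representation k (Points k A) (lieAlg k A) where
  toFun g :=
    { toFun := fun D => ⟨conjDerivation g D.1, conjDerivation_mem g D.2⟩
      map_add' := fun D E => by
        ext a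
        simp [conjDerivation_apply]
      map_smul' := fun c D => by
        ext a
        simp [conjDerivation_apply] }
  map_one' := by
    ext D a
    simp [conjDerivation_apply, rightTranslation_one]
  map_mul' g h := by
    ext D a
    simp [conjDerivation_apply, rightTranslation_mul]

variable {q : Type*} [LieRing q] [LieAlgebra k q]

/-- The coadjoint orbit `Qα = {α ∘ Ad(g⁻¹) | g ∈ Q(k)} ⊆ q*`, where `q` is identified with `Lie Q`
along the isomorphism `e`. -/
def coadjointOrbit (e : lieAlg k A ≃ₗ⁅k⁆ q) (α : Module.Dual k q) : Set (Module.Dual k q) :=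
  Set.range fun g : Points k A =>
    (Ad k A).dual g (α ∘ₗ (e : lieAlg k A →ₗ[k] q)) ∘ₗ (e.symm : q →ₗ[k] lieAlg k A)

/-- The orbit `Qα` is conical: `kˣ α ⊆ Qα`. -/
def IsConicalOrbit (e : lieAlg k A ≃ₗ⁅k⁆ q) (α : Module.Dual k q) : Prop :=
  ∀ c : k, c ≠ 0 → c • α ∈ coadjointOrbit e α

end Group

end ContactLie

end

/-! Part (i). Put ω = dα. Contracting ω with x ∈ q gives the coadjoint derivative x·α, so the
contractions of ω fill ad*(q)·α and the kernel of ω is q_α. Consider the skew matrix of α([x, y])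
bordered by a functional β: a kernel vector is a pair (x, c) with α([x, ·]) = cβ and β(x) = 0. If
ω^n ∧ α ≠ 0 in dimension 2n+1, the matrix bordered by α itself is invertible; this is an open
condition on α, and it forbids α ∈ ad*(q)·α. Conversely, index 1 gives some γ and β with invertible
bordered matrix. Skewness then forces dim q to be odd, and for generic α the form ω has rank 2n, so
ω^n ≠ 0. If also α ∉ ad*(q)·α, then α is nonzero on some z ∈ q_α, and contracting ω^n ∧ α with z
gives α(z) ω^n ≠ 0.

Part (ii) holds orbit by orbit: Qα is conical exactly when α ∈ ad*(q)·α, for every α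
(`isConicalOrbit_iff`). The tool is the family of regular functions f_D(g) = α(Ad(g) D), which
satisfy E f_D = f_[E,D] for E ∈ Lie Q. Fix v with α(v) = 1 and let c = f_v; where Ad(g) scales α,
the factor is c(g).

From conical to tangent: let Γ be the group of points scaling α, J its vanishing ideal and m the
augmentation ideal. If c - 1 ∉ m² + J, a functional killing m² + J but not c - 1 is a tangent vector
at the identity along which the character c varies, and it gives E with α([E, ·]) = α. Otherwise the
squaring map, which acts on m^n/m^(n+1) by 2^n, pushes c - 1 into every m^n + J. By Krull, c = 1 on
a neighbourhood of the identity in Γ, so by quasi-compactness c has finitely many values on Γ, which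
a conical orbit excludes.

From tangent to conical: let J be generated by the f_D - α(D)c. Then E preserves J and Ec ≡ c, so E
acts on polynomials in c as the Euler operator. This forces c to be transcendental modulo J, and
Chevalley's theorem makes all but finitely many scalars values of c. Quotients of such scalars give
all of kˣ. -/

noncomputable section

namespace ContactLie

/-! ### Contractions in the exterior algebra -/

section Exterior

variable {k M : Type*} [Field k] [AddCommGroup M] [Module k M]

/-- Contraction of an element of the exterior algebra with a linear functional. -/
def contract (d : Module.Dual k M) : ExteriorAlgebra k M →ₗ[k] ExteriorAlgebra k M :=
  CliffordAlgebra.contractLeft (Q := (0 : QuadraticForm k M)) d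

theorem contract_ι_mul (d : Module.Dual k M) (a : M) (b : ExteriorAlgebra k M) :
    contract d (ExteriorAlgebra.ι k a * b) = d a • b - ExteriorAlgebra.ι k a * contract d b :=
  CliffordAlgebra.contractLeft_ι_mul d a b

theorem contract_ι (d : Module.Dual k M) (a : M) :
    contract d (ExteriorAlgebra.ι k a) = algebraMap k _ (d a) :=
  CliffordAlgebra.contractLeft_ι _ d a

theorem contract_algebraMap (d : Module.Dual k M) (c : k) :
    contract d (algebraMap k (ExteriorAlgebra k M) c) = 0 :=
  CliffordAlgebra.contractLeft_algebraMap _ d c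

/-- Contraction is an antiderivation, and ω has even degree, so no sign appears. -/
theorem contract_two_form_mul (d : Module.Dual k M) {ω : ExteriorAlgebra k M}
    (hω : ω ∈ ⋀[k]^2 M) (b : ExteriorAlgebra k M) :
    contract d (ω * b) = contract d ω * b + ω * contract d b := by
  rw [ExteriorAlgebra.exteriorPower, pow_two] at hω
  induction hω using Submodule.mul_induction_on' with
  | mem_mul_mem x hx y hy =>
    obtain ⟨u, rfl⟩ := hx
    obtain ⟨v, rfl⟩ := hy
    simp only [mul_assoc, contract_ι_mul, contract_ι, mul_sub, sub_mul, smul_mul_assoc,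
      mul_smul_comm, Algebra.algebraMap_eq_smul_one, mul_one]
    abel
  | add x hx y hy h1 h2 =>
    simp only [add_mul, map_add, h1, h2]
    abel

theorem commute_two_form_ι {ω : ExteriorAlgebra k M} (hω : ω ∈ ⋀[k]^2 M) (a : M) :
    Commute ω (ExteriorAlgebra.ι k a) := by
  have swap (x y : M) : ExteriorAlgebra.ι k x * ExteriorAlgebra.ι k y =
      -(ExteriorAlgebra.ι k y * ExteriorAlgebra.ι k x) :=
    eq_neg_of_add_eq_zero_left (ExteriorAlgebra.ι_add_mul_swap x y)
  rw [ExteriorAlgebra.exteriorPower, pow_two] at hω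
  induction hω using Submodule.mul_induction_on' with
  | mem_mul_mem x hx y hy =>
    obtain ⟨u, rfl⟩ := hx
    obtain ⟨v, rfl⟩ := hy
    change _ * _ = _ * _
    rw [mul_assoc, swap v a, mul_neg, ← mul_assoc, swap u a, neg_mul, neg_neg, mul_assoc]
  | add x hx y hy h1 h2 => exact h1.add_left h2

/-- The power rule for a derivation, available because two-forms commute with one-forms. In
characteristic zero the factor n + 1 can be cancelled. -/
theorem contract_two_form_pow_succ (d : Module.Dual k M) {ω : ExteriorAlgebra k M}
    (hω : ω ∈ ⋀[k]^2 M) {a : M} (ha : contract d ω = ExteriorAlgebra.ι k a) (n : ℕ) :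
    contract d (ω ^ (n + 1)) = ((n + 1 : ℕ) : k) • (ExteriorAlgebra.ι k a * ω ^ n) := by
  induction n with
  | zero => simp [ha]
  | succ n ih =>
    rw [pow_succ' ω (n + 1), contract_two_form_mul d hω, ih, ha, mul_smul_comm, ← mul_assoc,
      (commute_two_form_ι hω a).eq, mul_assoc, ← pow_succ', Nat.cast_succ (n + 1), add_smul,
      one_smul, add_comm]

theorem contract_two_form_pow_mul (d : Module.Dual k M) {ω : ExteriorAlgebra k M}
    (hω : ω ∈ ⋀[k]^2 M) (hd : contract d ω = 0) (n : ℕ) (b : ExteriorAlgebra k M) :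
    contract d (ω ^ n * b) = ω ^ n * contract d b := by
  induction n with
  | zero => simp
  | succ n ih => rw [pow_succ', mul_assoc, contract_two_form_mul d hω, hd, ih, zero_mul, zero_add,
      mul_assoc]

theorem contract_mem_exteriorPower (d : Module.Dual k M) (n : ℕ) {x : ExteriorAlgebra k M}
    (hx : x ∈ ⋀[k]^(n + 1) M) : contract d x ∈ ⋀[k]^n M := by
  induction n generalizing x with
  | zero =>
    rw [ExteriorAlgebra.exteriorPower, zero_add, pow_one] at hx
    obtain ⟨a, rfl⟩ := hx
    rw [contract_ι, ExteriorAlgebra.exteriorPower, pow_zero]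
    exact Submodule.algebraMap_mem _
  | succ n ih =>
    rw [ExteriorAlgebra.exteriorPower, pow_succ'] at hx
    induction hx using Submodule.mul_induction_on' with
    | mem_mul_mem x hx y hy =>
      obtain ⟨a, rfl⟩ := hx
      rw [contract_ι_mul]
      refine sub_mem (Submodule.smul_mem _ _ hy) ?_
      rw [ExteriorAlgebra.exteriorPower, pow_succ']
      exact Submodule.mul_mem_mul ⟨a, rfl⟩ (ih hy)
    | add x hx y hy h1 h2 => rw [map_add]; exact add_mem h1 h2

/-- A form of degree `d` annihilated by more than `d` independent 1-forms vanishes. -/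
theorem eq_zero_of_ι_mul_eq_zero {d : ℕ} : ∀ {r : ℕ} (_ : d < r) (φ : Fin r → M)
    (x : Fin r → Module.Dual k M) (_ : ∀ i j, x i (φ j) = if i = j then 1 else 0)
    {η : ExteriorAlgebra k M} (_ : η ∈ ⋀[k]^d M) (_ : ∀ j, ExteriorAlgebra.ι k (φ j) * η = 0),
    η = 0 := by
  have key {a : M} {y : Module.Dual k M} (hy : y a = 1) {η : ExteriorAlgebra k M}
      (h : ExteriorAlgebra.ι k a * η = 0) : η = ExteriorAlgebra.ι k a * contract y η := by
    have := contract_ι_mul y a η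
    rw [h, map_zero, hy, one_smul] at this
    exact (sub_eq_zero.mp this.symm)
  induction d with
  | zero =>
    intro r hr φ x hx η hη h
    have h0 := key (by simpa using hx ⟨0, hr⟩ ⟨0, hr⟩) (h ⟨0, hr⟩)
    rw [ExteriorAlgebra.exteriorPower, pow_zero] at hη
    obtain ⟨c, rfl⟩ := Submodule.mem_one.mp hη
    rwa [contract_algebraMap, mul_zero] at h0
  | succ d ih =>
    intro r hr φ x hx η hη h
    obtain ⟨r, rfl⟩ : ∃ s, r = s + 1 := ⟨r - 1, by omega⟩
    have h0 := key (by simpa using hx 0 0) (h 0)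
    -- The contraction has degree one less and is still annihilated by the remaining one-forms, so
    -- induction applies.
    have h1 : contract (x 0) η = 0 := by
      refine ih (by omega : d < r) (fun j => φ j.succ) (fun j => x j.succ) (fun i j => ?_)
        (contract_mem_exteriorPower _ _ hη) (fun j => ?_)
      · rw [hx]; simp
      · have h2 := contract_ι_mul (x 0) (φ j.succ) η
        rw [h, map_zero, hx, if_neg (Fin.succ_ne_zero j).symm, zero_smul, zero_sub] at h2
        exact neg_eq_zero.mp h2.symm
    rw [h0, h1, mul_zero]

theorem eq_zero_of_ι_mul_eq_zero_of_finrank [FiniteDimensional k M] {d : ℕ} {η : ExteriorAlgebra k M}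
    (hη : η ∈ ⋀[k]^d M) (R : Submodule k M) (hR : d < Module.finrank k R)
    (h : ∀ a ∈ R, ExteriorAlgebra.ι k a * η = 0) : η = 0 := by
  obtain ⟨p, hp⟩ := R.subtype.exists_leftInverse_of_injective R.ker_subtype
  let b := Module.finBasis k R
  refine eq_zero_of_ι_mul_eq_zero hR (fun j => (b j : M)) (fun i => b.coord i ∘ₗ p)
    (fun i j => ?_) hη (fun j => h _ (b j).2)
  have : p (b j : M) = b j := LinearMap.congr_fun hp (b j)
  rw [LinearMap.comp_apply, this, b.coord_apply, b.repr_self, Finsupp.single_apply]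
  simp only [eq_comm]

theorem eq_zero_of_mem_exteriorPower [FiniteDimensional k M] {d : ℕ}
    (hd : Module.finrank k M < d) {x : ExteriorAlgebra k M} (hx : x ∈ ⋀[k]^d M) : x = 0 := by
  have h : Module.finrank k (⋀[k]^d M) = 0 := by
    rw [exteriorPower.finrank_eq, Nat.choose_eq_zero_of_lt hd]
  exact (Submodule.mem_bot k).mp (Submodule.finrank_eq_zero.mp h ▸ hx)

theorem pow_mem_exteriorPower {ω : ExteriorAlgebra k M} (hω : ω ∈ ⋀[k]^2 M) (n : ℕ) :
    ω ^ n ∈ ⋀[k]^(2 * n) M := by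
  rw [ExteriorAlgebra.exteriorPower, pow_mul]
  exact Submodule.pow_mem_pow _ hω n

/-- A power of a 2-form `ω` is nonzero as soon as the contractions of `ω` span a space of large
enough dimension. -/
theorem two_form_pow_ne_zero [CharZero k] [FiniteDimensional k M] {ω : ExteriorAlgebra k M}
    (hω : ω ∈ ⋀[k]^2 M) (R : Submodule k M)
    (h : ∀ a ∈ R, ∃ d, contract d ω = ExteriorAlgebra.ι k a) {n : ℕ}
    (hn : 2 * n ≤ Module.finrank k R) : ω ^ n ≠ 0 := by
  induction n with
  | zero => simp
  | succ n ih =>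
    intro h0
    -- If ω^(n+1) = 0, contracting it shows that every a ∈ R annihilates ω^n, whose degree 2n is
    -- less than dim R.
    refine ih (by omega) (eq_zero_of_ι_mul_eq_zero_of_finrank (pow_mem_exteriorPower hω n) R
      (by omega) fun a ha => ?_)
    obtain ⟨d, hd⟩ := h a ha
    have h1 := contract_two_form_pow_succ d hω hd n
    rw [h0, map_zero] at h1
    exact (smul_eq_zero.mp h1.symm).resolve_left (Nat.cast_ne_zero.mpr n.succ_ne_zero)

end Exterior

/-! ### Generic nonvanishing of determinants -/

section Generic

variable {k : Type*} [Field k] {V : Type*} [AddCommGroup V] [Module k V]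

theorem generically_eval_ne_zero (f : MvPolynomial (Module.Dual k V) k) (v : V)
    (hv : MvPolynomial.eval (fun φ : Module.Dual k V => φ v) f ≠ 0) :
    Generically k fun w : V => MvPolynomial.eval (fun φ : Module.Dual k V => φ w) f ≠ 0 :=
  ⟨_, ⟨{f}, rfl⟩, ⟨v, by simpa using hv⟩, fun w hw => by simpa using hw⟩

theorem Generically.mono {P P' : V → Prop} (h : Generically k P) (hP : ∀ v, P v → P' v) :
    Generically k P' := by
  obtain ⟨U, hU, hne, h⟩ := h
  exact ⟨U, hU, hne, fun v hv => hP v (h v hv)⟩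

/-- Join a point of each open set by a line. The two defining polynomials restrict to nonzero
polynomials in one variable, and over an infinite field their product has a non-root. -/
theorem Generically.exists_and [Infinite k] {P P' : V → Prop} (h : Generically k P)
    (h' : Generically k P') : ∃ v, P v ∧ P' v := by
  obtain ⟨_, ⟨S, rfl⟩, ⟨v, f, hf, hv⟩, h⟩ := h
  obtain ⟨_, ⟨S', rfl⟩, ⟨v', f', hf', hv'⟩, h'⟩ := h'
  let line : MvPolynomial (Module.Dual k V) k →ₐ[k] Polynomial k :=
    MvPolynomial.aeval fun φ => Polynomial.C (φ v) + Polynomial.X * Polynomial.C (φ (v' - v))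
  have heval (t : k) (g) : (line g).eval t =
      MvPolynomial.eval (fun φ : Module.Dual k V => φ (v + t • (v' - v))) g := by
    rw [← Polynomial.coe_evalRingHom, ← RingHom.coe_coe line, ← RingHom.comp_apply]
    congr 1
    ext φ <;> simp [line]
  have hne : line f * line f' ≠ 0 := by
    refine mul_ne_zero (fun h0 => hv ?_) (fun h0 => hv' ?_)
    · have := heval 0 f
      simpa [h0] using this.symm
    · have := heval 1 f'
      simpa [h0] using this.symm
  obtain ⟨t, ht⟩ := Polynomial.exists_eval_ne_zero_of_natDegree_lt_card _ hne
    (Cardinal.natCast_lt_aleph0.trans_le (Cardinal.aleph0_le_mk k))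
  rw [Polynomial.eval_mul, heval, heval] at ht
  exact ⟨_, h _ ⟨f, hf, left_ne_zero_of_mul ht⟩, h' _ ⟨f', hf', right_ne_zero_of_mul ht⟩⟩

theorem generically_det_ne_zero {ι : Type*} [Fintype ι] [DecidableEq ι] (N : V → Matrix ι ι k)
    (P : Matrix ι ι (MvPolynomial (Module.Dual k V) k))
    (hP : ∀ v i j, MvPolynomial.eval (fun φ : Module.Dual k V => φ v) (P i j) = N v i j)
    (v : V) (hv : (N v).det ≠ 0) : Generically k fun w => (N w).det ≠ 0 := by
  have h (w : V) : MvPolynomial.eval (fun φ : Module.Dual k V => φ w) P.det = (N w).det := by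
    rw [RingHom.map_det]
    congr 1
    ext i j
    exact hP w i j
  exact (generically_eval_ne_zero P.det v (by rwa [h])).mono fun w hw => by rwa [h] at hw

end Generic

/-! ### The bordered matrix of the form `α([x, y])` -/

section Lie

variable {k : Type*} [Field k] {q : Type*} [LieRing q] [LieAlgebra k q]

theorem mem_adStar {α β : Module.Dual k q} :
    β ∈ adStar k α ↔ ∃ x : q, ∀ y, β y = -α ⁅x, y⁆ := by
  simp [adStar, LinearMap.ext_iff, eq_comm]

variable [FiniteDimensional k q]

/-- The matrix of the form `α([x, y])`, bordered by `β`. -/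
def borderedMatrix (α β : Module.Dual k q) :
    Matrix (Fin (Module.finrank k q) ⊕ Unit) (Fin (Module.finrank k q) ⊕ Unit) k :=
  Matrix.fromBlocks
    (Matrix.of fun i j => α ⁅Module.finBasis k q i, Module.finBasis k q j⁆)
    (Matrix.of fun i _ => β (Module.finBasis k q i))
    (Matrix.of fun _ j => -β (Module.finBasis k q j)) 0

theorem borderedMatrix_transpose (α β : Module.Dual k q) :
    (borderedMatrix α β).transpose = -borderedMatrix α β := by
  ext (i | i) (j | j)
  · simp [borderedMatrix, ← map_neg]
  all_goals simp [borderedMatrix]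

/-- A skew matrix of odd order is singular outside characteristic 2, and the border raises the order
to dim q + 1. -/
theorem odd_finrank_of_borderedMatrix_det_ne_zero [CharZero k] {α β : Module.Dual k q}
    (h : (borderedMatrix α β).det ≠ 0) : Odd (Module.finrank k q) := by
  by_contra hodd
  rw [Nat.not_odd_iff_even] at hodd
  have h1 := Matrix.det_transpose (borderedMatrix α β)
  rw [borderedMatrix_transpose, Matrix.det_neg, Fintype.card_sum, Fintype.card_fin,
    Fintype.card_unit, hodd.add_one.neg_one_pow, neg_one_mul] at h1
  exact h (self_eq_neg.mp h1.symm)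

/-- A left kernel vector consists of the coordinates of x together with the border entry c. -/
theorem borderedMatrix_det_ne_zero_iff {α β : Module.Dual k q} :
    (borderedMatrix α β).det ≠ 0 ↔
      ∀ (x : q) (c : k), (∀ y, α ⁅x, y⁆ = c * β y) → β x = 0 → x = 0 ∧ c = 0 := by
  set b := Module.finBasis k q with hb
  have hmul (v : Fin (Module.finrank k q) ⊕ Unit → k) :
      Matrix.vecMul v (borderedMatrix α β) = 0 ↔
        (∀ y, α ⁅b.equivFun.symm (v ∘ Sum.inl), y⁆ = v (Sum.inr ()) * β y) ∧
          β (b.equivFun.symm (v ∘ Sum.inl)) = 0 := by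
    have h1 : (∀ y, α ⁅b.equivFun.symm (v ∘ Sum.inl), y⁆ = v (Sum.inr ()) * β y) ↔
        ∀ j, α ⁅b.equivFun.symm (v ∘ Sum.inl), b j⁆ = v (Sum.inr ()) * β (b j) := by
      refine ⟨fun h j => h _, fun h y => ?_⟩
      have : α ∘ₗ (LieAlgebra.ad k q (b.equivFun.symm (v ∘ Sum.inl))) = v (Sum.inr ()) • β :=
        b.ext h
      exact LinearMap.congr_fun this y
    rw [h1, funext_iff, Sum.forall]
    simp only [borderedMatrix, Matrix.vecMul, dotProduct, Fintype.sum_sum_type,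
      Matrix.fromBlocks_apply₁₁, Matrix.fromBlocks_apply₁₂, Matrix.fromBlocks_apply₂₁,
      Matrix.fromBlocks_apply₂₂, Matrix.of_apply, ← hb, b.equivFun_symm_apply, sum_lie, smul_lie,
      map_sum, map_smul, smul_eq_mul, Function.comp_apply]
    simp [add_neg_eq_zero]
  rw [← not_iff_not, not_not, ← Matrix.exists_vecMul_eq_zero_iff]
  push Not
  constructor
  · rintro ⟨v, hv, h⟩
    obtain ⟨h1, h2⟩ := (hmul v).mp h
    refine ⟨_, _, h1, h2, fun h3 h4 => hv ?_⟩
    rw [b.equivFun.symm.map_eq_zero_iff] at h3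
    ext (i | i)
    · exact congr_fun h3 i
    · exact h4
  · rintro ⟨x, c, h1, h2, h3⟩
    refine ⟨Sum.elim (b.equivFun x) fun _ => c, fun h0 => ?_, (hmul _).mpr ?_⟩
    · refine h3 ?_ (congr_fun h0 (Sum.inr ()))
      rw [← b.equivFun.map_eq_zero_iff]
      ext i
      exact congr_fun h0 (Sum.inl i)
    · rw [Sum.elim_comp_inl, LinearEquiv.symm_apply_apply]
      exact ⟨h1, h2⟩

theorem generically_borderedMatrix_det_ne_zero {γ β : Module.Dual k q}
    (h : (borderedMatrix γ β).det ≠ 0) :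
    Generically k fun α : Module.Dual k q => (borderedMatrix α β).det ≠ 0 := by
  let X (x : q) : MvPolynomial (Module.Dual k (Module.Dual k q)) k :=
    MvPolynomial.X (Module.Dual.eval k q x)
  refine generically_det_ne_zero (fun α => borderedMatrix α β) (Matrix.fromBlocks
    (Matrix.of fun i j => X ⁅Module.finBasis k q i, Module.finBasis k q j⁆)
    (Matrix.of fun i _ => MvPolynomial.C (β (Module.finBasis k q i)))
    (Matrix.of fun _ j => -MvPolynomial.C (β (Module.finBasis k q j))) 0) ?_ γ h
  rintro α (i | i) (j | j) <;> simp [borderedMatrix, X]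

theorem generically_borderedMatrix_self_det_ne_zero {γ : Module.Dual k q}
    (h : (borderedMatrix γ γ).det ≠ 0) :
    Generically k fun α : Module.Dual k q => (borderedMatrix α α).det ≠ 0 := by
  let X (x : q) : MvPolynomial (Module.Dual k (Module.Dual k q)) k :=
    MvPolynomial.X (Module.Dual.eval k q x)
  refine generically_det_ne_zero (fun α => borderedMatrix α α) (Matrix.fromBlocks
    (Matrix.of fun i j => X ⁅Module.finBasis k q i, Module.finBasis k q j⁆)
    (Matrix.of fun i _ => X (Module.finBasis k q i))
    (Matrix.of fun _ j => -X (Module.finBasis k q j)) 0) ?_ γ h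
  rintro α (i | i) (j | j) <;> simp [borderedMatrix, X]

theorem not_mem_adStar_of_borderedMatrix_det_ne_zero {α : Module.Dual k q}
    (h : (borderedMatrix α α).det ≠ 0) : α ∉ adStar k α := by
  intro hα
  obtain ⟨x, hx⟩ := mem_adStar.mp hα
  have := borderedMatrix_det_ne_zero_iff.mp h x (-1) (fun y => by rw [hx y]; ring)
    (by rw [hx x]; simp)
  simp at this

/-- This is where index 1 enters: take β nonzero on a generator z of the stabiliser. Evaluating at z
forces c = 0, so x is a multiple of z, and β(x) = 0 kills it. -/
theorem exists_borderedMatrix_det_ne_zero {γ : Module.Dual k q}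
    (h : Module.finrank k (stabiliser k γ) = 1) :
    ∃ β : Module.Dual k q, (borderedMatrix γ β).det ≠ 0 := by
  obtain ⟨⟨z, hz⟩, hz0, hspan⟩ := finrank_eq_one_iff'.mp h
  have hz0' : z ≠ 0 := fun h0 => hz0 (Subtype.ext h0)
  obtain ⟨β, hβ⟩ : ∃ β : Module.Dual k q, β z ≠ 0 := by
    by_contra! hβ
    exact hz0' ((Module.forall_dual_apply_eq_zero_iff k z).mp hβ)
  refine ⟨β, borderedMatrix_det_ne_zero_iff.mpr fun x c hx hβx => ?_⟩
  have hc : c = 0 := by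
    have := hx z
    rw [← lie_skew, map_neg, hz x, neg_zero, eq_comm, mul_eq_zero] at this
    exact this.resolve_right hβ
  obtain ⟨t, ht⟩ := hspan ⟨x, fun y => by rw [hx y, hc, zero_mul]⟩
  obtain rfl : t • z = x := congrArg Subtype.val ht
  rw [map_smul, smul_eq_mul, mul_eq_zero] at hβx
  rw [hβx.resolve_right hβ, zero_smul]
  exact ⟨rfl, hc⟩

/-! ### Contact forms -/

variable (α : Module.Dual k q)

/-- The bridge between exterior algebra and the coadjoint action: the factor 1/2 cancels because
each pair of basis vectors is counted twice. -/
theorem contract_ceDifferential [CharZero k] (x : q) :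
    contract (Module.Dual.eval k q x)
      (ceDifferential k α : ExteriorAlgebra k (Module.Dual k q)) =
      ExteriorAlgebra.ι k (⁅x, α⁆ : Module.Dual k q) := by
  set b := Module.finBasis k q with hb
  have key : (⁅x, α⁆ : Module.Dual k q) = ∑ i, ∑ j, (-(1 / 2 : k) * α ⁅b i, b j⁆) •
      (b.coord i x • b.coord j - b.coord j x • b.coord i) := by
    have expand (u v : q) : ∑ i, ∑ j, α ⁅b i, b j⁆ * (b.repr u i * b.repr v j) = α ⁅u, v⁆ := by
      conv_rhs => rw [← b.sum_repr u, ← b.sum_repr v, sum_lie, map_sum]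
      refine Finset.sum_congr rfl fun i _ => ?_
      rw [lie_sum, map_sum]
      refine Finset.sum_congr rfl fun j _ => ?_
      simp
      ring
    ext y
    have h1 : (⁅x, α⁆ : Module.Dual k q) y = -(1 / 2) * (α ⁅x, y⁆ - α ⁅y, x⁆) := by
      have h2 : α ⁅y, x⁆ = -α ⁅x, y⁆ := by rw [← lie_skew, map_neg]
      rw [h2]
      simp
      ring
    rw [h1, ← expand, ← expand, ← Finset.sum_sub_distrib, Finset.mul_sum, LinearMap.sum_apply]
    refine Finset.sum_congr rfl fun i _ => ?_
    rw [← Finset.sum_sub_distrib, Finset.mul_sum, LinearMap.sum_apply]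
    refine Finset.sum_congr rfl fun j _ => ?_
    simp
    ring
  rw [key]
  simp only [ceDifferential, Submodule.coe_sum, Submodule.coe_smul, map_sum, map_smul, ← hb,
    exteriorPower.ιMulti_apply_coe, ExteriorAlgebra.ιMulti_apply]
  refine Finset.sum_congr rfl fun i _ => Finset.sum_congr rfl fun j _ => ?_
  congr 1
  simp [List.ofFn_succ, contract_ι_mul, contract_ι, Algebra.algebraMap_eq_smul_one]

theorem borderedMatrix_det_ne_zero_of_contact [CharZero k] {n : ℕ}
    (hn : Module.finrank k q = 2 * n + 1)
    (h : (ceDifferential k α : ExteriorAlgebra k (Module.Dual k q)) ^ n *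
      ExteriorAlgebra.ι k α ≠ 0) : (borderedMatrix α α).det ≠ 0 := by
  have hω := (ceDifferential k α).2
  set ω := (ceDifferential k α : ExteriorAlgebra k (Module.Dual k q))
  have hdim : Module.finrank k (Module.Dual k q) = 2 * n + 1 := by
    rw [Subspace.dual_finrank_eq, hn]
  rw [borderedMatrix_det_ne_zero_iff]
  intro x c hx hαx
  have hlie : (⁅x, α⁆ : Module.Dual k q) = -c • α := by
    ext y
    simp [hx y]
  have hx' := contract_ceDifferential α x
  have hc : c = 0 := by
    by_contra hc
    -- ω^(n+1) vanishes for reasons of degree; its contraction with x is -(n+1)c times α ∧ ω^n.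
    have h1 := contract_two_form_pow_succ _ hω hx' n
    rw [eq_zero_of_mem_exteriorPower (by omega) (pow_mem_exteriorPower hω (n + 1)), map_zero,
      hlie, map_smul, smul_mul_assoc, smul_smul, eq_comm, smul_eq_zero] at h1
    rcases h1 with h1 | h1
    · exact mul_ne_zero (Nat.cast_ne_zero.mpr n.succ_ne_zero) (neg_ne_zero.mpr hc) h1
    · rw [← ((commute_two_form_ι hω α).pow_left n).eq] at h1
      exact h h1
  refine ⟨by_contra fun hx0 => h ?_, hc⟩
  rw [hc, neg_zero, zero_smul] at hlie
  rw [hlie, map_zero] at hx'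
  obtain ⟨φ, hφ⟩ : ∃ φ : Module.Dual k q, φ x ≠ 0 := by
    by_contra! hφ
    exact hx0 ((Module.forall_dual_apply_eq_zero_iff k x).mp hφ)
  -- Now x contracts both ω and α to zero. Contracting the form φ ∧ ω^n ∧ α, zero by degree, leaves
  -- φ(x) ω^n ∧ α.
  have htop : ExteriorAlgebra.ι k φ * (ω ^ n * ExteriorAlgebra.ι k α) = 0 := by
    refine eq_zero_of_mem_exteriorPower (d := 2 * n + 2) (by omega) ?_
    rw [ExteriorAlgebra.exteriorPower, show 2 * n + 2 = (1 + 2 * n) + 1 by ring, pow_succ, pow_add, pow_one,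
      ← mul_assoc]
    exact Submodule.mul_mem_mul (Submodule.mul_mem_mul ⟨φ, rfl⟩ (pow_mem_exteriorPower hω n))
      ⟨α, rfl⟩
  have h1 := contract_ι_mul (Module.Dual.eval k q x) φ (ω ^ n * ExteriorAlgebra.ι k α)
  rw [htop, map_zero, contract_two_form_pow_mul _ hω hx', contract_ι, Module.Dual.eval_apply,
    Module.Dual.eval_apply, hαx, map_zero, mul_zero, mul_zero, sub_zero] at h1
  exact (smul_eq_zero.mp h1.symm).resolve_left hφ

theorem contact_of_not_mem_adStar [CharZero k] {β : Module.Dual k q} {n : ℕ}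
    (hn : Module.finrank k q = 2 * n + 1) (hβ : (borderedMatrix α β).det ≠ 0)
    (hα : α ∉ adStar k α) :
    (ceDifferential k α : ExteriorAlgebra k (Module.Dual k q)) ^ n *
      ExteriorAlgebra.ι k α ≠ 0 := by
  have hω := (ceDifferential k α).2
  set ω := (ceDifferential k α : ExteriorAlgebra k (Module.Dual k q))
  let T : q →ₗ[k] Module.Dual k q :=
    { toFun := fun x => ⁅x, α⁆
      map_add' := fun x y => add_lie x y α
      map_smul' := fun c x => smul_lie c x α }
  have hT (x y : q) : T x y = -α ⁅x, y⁆ := by simp [T]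
  -- In finite dimension ad*(q)·α is the annihilator of its own coannihilator, so a functional
  -- outside it is detected by some z.
  obtain ⟨z, hz, hαz⟩ : ∃ z, (∀ x, T x z = 0) ∧ α z ≠ 0 := by
    by_contra! hcon
    refine hα ?_
    have h1 : α ∈ (LinearMap.range T).dualCoannihilator.dualAnnihilator := by
      rw [Submodule.mem_dualAnnihilator]
      intro z hz
      rw [Submodule.mem_dualCoannihilator] at hz
      exact hcon z fun x => hz _ ⟨x, rfl⟩
    rw [Subspace.dualCoannihilator_dualAnnihilator_eq] at h1
    exact h1
  have hker : Module.finrank k (LinearMap.ker T) ≤ 1 := by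
    rw [borderedMatrix_det_ne_zero_iff] at hβ
    have hinj : Function.Injective (β ∘ₗ (LinearMap.ker T).subtype) := by
      rw [injective_iff_map_eq_zero]
      rintro ⟨x, hx⟩ hx0
      refine Subtype.ext (hβ x 0 (fun y => ?_) hx0).1
      have := hT x y
      rw [LinearMap.mem_ker.mp hx] at this
      simpa using this
    simpa using LinearMap.finrank_le_finrank_of_injective hinj
  have hrange : 2 * n ≤ Module.finrank k (LinearMap.range T) := by
    have := LinearMap.finrank_range_add_finrank_ker T
    omega
  have hzω : contract (Module.Dual.eval k q z) ω = 0 := by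
    have h0 : (⁅z, α⁆ : Module.Dual k q) = 0 := by
      ext y
      have := hz y
      rw [hT, ← lie_skew, map_neg, neg_neg] at this
      simp [this]
    rw [contract_ceDifferential, h0, map_zero]
  intro h0
  have h1 := contract_two_form_pow_mul _ hω hzω n (ExteriorAlgebra.ι k α)
  rw [h0, map_zero, contract_ι, Algebra.algebraMap_eq_smul_one, mul_smul_comm, mul_one, eq_comm,
    smul_eq_zero] at h1
  refine two_form_pow_ne_zero hω (LinearMap.range T) ?_ hrange (h1.resolve_left hαz)
  rintro _ ⟨x, rfl⟩
  exact ⟨_, contract_ceDifferential α x⟩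

theorem isContact_iff_generically [CharZero k] (hq : index k q = 1) :
    IsContact k q ↔ Generically k fun α : Module.Dual k q => α ∉ adStar k α := by
  constructor
  · rintro ⟨n, hn, α, hα⟩
    exact (generically_borderedMatrix_self_det_ne_zero
      (borderedMatrix_det_ne_zero_of_contact α hn hα)).mono
        fun _ => not_mem_adStar_of_borderedMatrix_det_ne_zero
  · intro h
    obtain ⟨γ, hγ⟩ : 1 ∈ Set.range fun γ : Module.Dual k q =>
        Module.finrank k (stabiliser k γ) := hq ▸ Nat.sInf_mem (Set.range_nonempty _)
    obtain ⟨β, hβ⟩ := exists_borderedMatrix_det_ne_zero hγ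
    obtain ⟨α, hα, hαβ⟩ := h.exists_and (generically_borderedMatrix_det_ne_zero hβ)
    obtain ⟨n, hn⟩ := odd_finrank_of_borderedMatrix_det_ne_zero hβ
    exact ⟨n, hn, α, contact_of_not_mem_adStar α hn hαβ hα⟩

end Lie

/-! ### Invariant derivations and matrix coefficients of the coadjoint representation -/

section Group

open WithConv

variable {k : Type*} [Field k] {A : Type*} [CommRing A] [HopfAlgebra k A]

/-- Apply id ⊗ ε to the left invariance identity: an invariant derivation is recovered from its
value at the identity. -/
theorem toConv_eq_id_mul_of_mem_lieAlg {D : Derivation k A A} (hD : D ∈ lieAlg k A) :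
    toConv (D : A →ₗ[k] A) = toConv (LinearMap.id : A →ₗ[k] A) *
      toConv (Algebra.linearMap k A ∘ₗ Coalgebra.counit ∘ₗ (D : A →ₗ[k] A)) := by
  ext a
  have h := congrArg ((TensorProduct.rid k A).toLinearMap ∘ₗ
    (Coalgebra.counit (R := k) (A := A)).lTensor A) (hD a)
  rw [LinearMap.comp_apply, Coalgebra.lTensor_counit_comul, LinearMap.comp_apply,
    ← LinearMap.comp_apply, ← LinearMap.comp_apply, LinearMap.comp_assoc,
    ← LinearMap.lTensor_comp] at h
  rw [(Coalgebra.Repr.arbitrary k a).convMul_apply]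
  rw [← (Coalgebra.Repr.arbitrary k a).eq] at h
  simpa [Algebra.smul_def, mul_comm] using h

theorem toConv_mul_counit_of_mem_lieAlg {E : Derivation k A A} (hE : E ∈ lieAlg k A)
    (D : A →ₗ[k] A) :
    toConv D * toConv (Algebra.linearMap k A ∘ₗ Coalgebra.counit ∘ₗ (E : A →ₗ[k] A)) =
      toConv (D ∘ₗ (E : A →ₗ[k] A)) := by
  ext a
  have h := congrArg (fun f => D (f.ofConv a)) (toConv_eq_id_mul_of_mem_lieAlg hE)
  simp only [(Coalgebra.Repr.arbitrary k a).convMul_apply, map_sum] at h ⊢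
  rw [LinearMap.comp_apply]
  refine Eq.trans ?_ h.symm
  refine Finset.sum_congr rfl fun i _ => ?_
  simp [mul_comm _ (algebraMap k A _), ← Algebra.smul_def]

/-- The function `g ↦ ε((Ad(g) D) a)` on the group. -/
def adCoeff (D : Derivation k A A) (a : A) : A :=
  (toConv (D : A →ₗ[k] A) * toConv (HopfAlgebra.antipode k)).ofConv a

theorem derivation_comp_convMul (E : Derivation k A A) (f g : WithConv (A →ₗ[k] A)) :
    toConv ((E : A →ₗ[k] A) ∘ₗ (f * g).ofConv) =
      toConv ((E : A →ₗ[k] A) ∘ₗ f.ofConv) * g + f * toConv ((E : A →ₗ[k] A) ∘ₗ g.ofConv) := by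
  ext a
  change E ((f * g) a) = (toConv ((E : A →ₗ[k] A) ∘ₗ f.ofConv) * g) a +
    (f * toConv ((E : A →ₗ[k] A) ∘ₗ g.ofConv)) a
  rw [(Coalgebra.Repr.arbitrary k a).convMul_apply,
   (Coalgebra.Repr.arbitrary k a).convMul_apply, (Coalgebra.Repr.arbitrary k a).convMul_apply,
    map_sum, ← Finset.sum_add_distrib]
  refine Finset.sum_congr rfl fun i _ => ?_
  simp
  ring

/-- Differentiate id * S = 1, use E(1) = 0, and cancel id by convolving with S on the left. -/
theorem derivation_comp_antipode {E : Derivation k A A} (hE : E ∈ lieAlg k A) :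
    toConv ((E : A →ₗ[k] A) ∘ₗ HopfAlgebra.antipode k) =
      -(toConv (Algebra.linearMap k A ∘ₗ Coalgebra.counit ∘ₗ (E : A →ₗ[k] A)) *
        toConv (HopfAlgebra.antipode k)) := by
  have h := derivation_comp_convMul E (toConv LinearMap.id) (toConv (HopfAlgebra.antipode k))
  have h0 : toConv ((E : A →ₗ[k] A) ∘ₗ (1 : WithConv (A →ₗ[k] A)).ofConv) = 0 := by
    ext a
    simp [LinearMap.convOne_def]
  rw [LinearMap.id_mul_antipode, h0] at h
  replace h := congrArg (toConv (HopfAlgebra.antipode k) * ·) h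
  simp only [mul_zero, mul_add, ← mul_assoc, LinearMap.antipode_mul_id, one_mul,
    LinearMap.comp_id] at h
  rw [toConv_eq_id_mul_of_mem_lieAlg hE, ← mul_assoc, LinearMap.antipode_mul_id, one_mul] at h
  exact eq_neg_of_add_eq_zero_right h.symm

/-- The infinitesimal form of Ad. In E(D * S), the Leibniz rule gives ED * S from the first factor,
and the derivative of the antipode gives -DE * S from the second. -/
theorem apply_adCoeff {E : Derivation k A A} (hE : E ∈ lieAlg k A) (D : Derivation k A A) (a : A) :
    E (adCoeff D a) = adCoeff ⁅E, D⁆ a := by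
  have h := derivation_comp_convMul E (toConv (D : A →ₗ[k] A)) (toConv (HopfAlgebra.antipode k))
  rw [ofConv_toConv, ofConv_toConv, derivation_comp_antipode hE, mul_neg, ← mul_assoc,
    toConv_mul_counit_of_mem_lieAlg hE, ← sub_eq_add_neg, ← sub_mul] at h
  refine (congrArg (fun f => f.ofConv a) h).trans ?_
  rw [adCoeff, Derivation.commutator_coe_linear_map]
  rfl

theorem point_adCoeff (g : Points k A) (D : Derivation k A A) (a : A) :
    g.ofConv (adCoeff D a) = Coalgebra.counit (R := k) (conjDerivation g D a) := by
  have h1 (f : A) : Coalgebra.counit (R := k) (rightTranslation g f) = g.ofConv f := by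
    have h2 : (Bialgebra.counitAlgHom k A).comp (rightTranslation g) = g.ofConv := by
      rw [rightTranslation, AlgHom.comp_convMul_distrib]
      have h3 : toConv ((Bialgebra.counitAlgHom k A).comp (AlgHom.id k A)) = (1 : Points k A) := by
        ext; simp [AlgHom.convOne_def]
      have h4 : toConv ((Bialgebra.counitAlgHom k A).comp
          ((Algebra.ofId k A).comp g.ofConv)) = g := by
        ext; simp [Algebra.ofId_apply]
      simp only [h3, h4, one_mul]
    exact DFunLike.congr_fun h2 f
  rw [conjDerivation_apply, h1, adCoeff]
  rw [(Coalgebra.Repr.arbitrary k a).convMul_apply]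
  have h5 : rightTranslation g⁻¹ a = ∑ i ∈ (Coalgebra.Repr.arbitrary k a).index,
      (g.ofConv (HopfAlgebra.antipode k ((Coalgebra.Repr.arbitrary k a).right i))) •
        (Coalgebra.Repr.arbitrary k a).left i := by
    change (toConv (AlgHom.id k A) * toConv ((Algebra.ofId k A).comp g⁻¹.ofConv)) a = _
    rw [AlgHom.convMul_apply, ← (Coalgebra.Repr.arbitrary k a).eq, map_sum]
    refine Finset.sum_congr rfl fun i _ => ?_
    rw [Algebra.TensorProduct.lift_tmul, Algebra.smul_def, mul_comm]
    rfl
  rw [h5]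
  simp [mul_comm]

theorem counit_adCoeff (D : Derivation k A A) (a : A) :
    Coalgebra.counit (R := k) (adCoeff D a) = Coalgebra.counit (R := k) (D a) := by
  have h := point_adCoeff (1 : Points k A) D a
  rw [conjDerivation_apply, inv_one, rightTranslation_one] at h
  exact h

/-- Elements of the Lie algebra are determined by their values at the identity. -/
theorem eq_zero_of_counit_eq_zero {D : Derivation k A A} (hD : D ∈ lieAlg k A)
    (h : ∀ a, Coalgebra.counit (R := k) (D a) = 0) : D = 0 := by
  have h0 : Coalgebra.counit (R := k) ∘ₗ (D : A →ₗ[k] A) = 0 := LinearMap.ext h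
  have h1 := toConv_eq_id_mul_of_mem_lieAlg hD
  rw [h0, LinearMap.comp_zero, toConv_zero, mul_zero] at h1
  ext a
  exact congrArg (fun f => f.ofConv a) h1

/-- The functionals D ↦ ε(D a) have no common zero except D = 0, so in finite dimension they exhaust
the dual. This makes g ↦ α(Ad(g) D) a regular function. -/
theorem exists_dual_eq_counit [FiniteDimensional k (lieAlg k A)]
    (α : Module.Dual k (lieAlg k A)) :
    ∃ a : A, ∀ D : lieAlg k A, α D = Coalgebra.counit (R := k) (D.1 a) := by
  let Φ : A →ₗ[k] Module.Dual k (lieAlg k A) := LinearMap.mk₂ k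
    (fun a D => Coalgebra.counit (R := k) (D.1 a)) (by simp) (by simp) (by simp) (by simp)
  have h : (LinearMap.range Φ).dualCoannihilator = ⊥ := by
    rw [eq_bot_iff]
    intro D hD
    rw [Submodule.mem_dualCoannihilator] at hD
    exact Subtype.ext (eq_zero_of_counit_eq_zero D.2 fun a => hD _ ⟨a, rfl⟩)
  have h1 : LinearMap.range Φ = ⊤ := by
    rw [← Subspace.dualCoannihilator_dualAnnihilator_eq (W := LinearMap.range Φ), h,
      Submodule.dualAnnihilator_bot]
  obtain ⟨a, ha⟩ := LinearMap.range_eq_top.mp h1 α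
  exact ⟨a, fun D => (LinearMap.congr_fun ha D).symm⟩

/-- Every point derivation at the identity extends to an invariant derivation. -/
theorem exists_mem_lieAlg_counit_eq (δ : A →ₗ[k] k)
    (hδ : ∀ a b, δ (a * b) = Coalgebra.counit (R := k) a * δ b + Coalgebra.counit (R := k) b * δ a) :
    ∃ E ∈ lieAlg k A, ∀ a, Coalgebra.counit (R := k) (E a) = δ a := by
  let T : A ⊗[k] A →ₗ[k] A := (TensorProduct.rid k A).toLinearMap ∘ₗ δ.lTensor A
  let R : A ⊗[k] A →ₗ[k] A := (TensorProduct.rid k A).toLinearMap ∘ₗ Coalgebra.counit.lTensor A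
  have hT (x y : A) : T (x ⊗ₜ y) = δ y • x := by simp [T]
  have hR (x y : A) : R (x ⊗ₜ y) = Coalgebra.counit (R := k) y • x := by simp [R]
  have hRc (a : A) : R (Coalgebra.comul a) = a := by simp [R]
  -- The Leibniz rule for id ⊗ δ over id ⊗ ε; composed with the comultiplication it makes (id ⊗ δ)Δ
  -- a derivation.
  have hmul (p p' : A ⊗[k] A) : T (p * p') = R p * T p' + R p' * T p := by
    induction p with
    | zero => simp
    | add p₁ p₂ h₁ h₂ => simp only [add_mul, map_add, mul_add, h₁, h₂]; ring
    | tmul x y =>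
      induction p' with
      | zero => simp
      | add p₁ p₂ h₁ h₂ => simp only [add_mul, map_add, mul_add, h₁, h₂]; ring
      | tmul x' y' =>
        rw [Algebra.TensorProduct.tmul_mul_tmul, hT, hT, hT, hR, hR, hδ]
        simp only [Algebra.smul_def, map_add, map_mul]
        ring
  refine ⟨Derivation.mk' (T ∘ₗ Coalgebra.comul) fun a b => ?_, fun a => ?_, fun a => ?_⟩
  · simp only [LinearMap.comp_apply, Bialgebra.comul_mul, hmul, hRc, smul_eq_mul]
  · change Coalgebra.comul (T (Coalgebra.comul a)) =
      (T ∘ₗ Coalgebra.comul).lTensor A (Coalgebra.comul a)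
    have h1 (p : A ⊗[k] A) : Coalgebra.comul (R := k) (T p) =
        T.lTensor A (TensorProduct.assoc k A A A (Coalgebra.comul.rTensor A p)) := by
      induction p with
      | zero => simp
      | add p₁ p₂ h₁ h₂ => simp only [map_add, h₁, h₂]
      | tmul x y =>
        rw [hT, map_smul, LinearMap.rTensor_tmul]
        generalize Coalgebra.comul (R := k) x = z
        induction z with
        | zero => simp
        | add p₁ p₂ h₁ h₂ => simp only [map_add, TensorProduct.add_tmul, smul_add, h₁, h₂]
        | tmul x' y' => simp [hT]
    rw [h1, Coalgebra.coassoc_apply]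
    exact (LinearMap.lTensor_comp_apply A T Coalgebra.comul _).symm
  · change Coalgebra.counit (R := k) (T (Coalgebra.comul a)) = _
    have h1 (p : A ⊗[k] A) : Coalgebra.counit (R := k) (T p) =
        δ (TensorProduct.lid k A (Coalgebra.counit.rTensor A p)) := by
      induction p with
      | zero => simp
      | add p₁ p₂ h₁ h₂ => simp only [map_add, h₁, h₂]
      | tmul x y => simp [hT, mul_comm]
    rw [h1, Coalgebra.rTensor_counit_comul]
    simp

end Group

/-! ### The squaring map and the powers of the augmentation ideal -/

section Augmentation

open WithConv

/-- ψ is multiplicative, so doubling on m/m² becomes multiplication by 2^n on m^n/m^(n+1). -/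
theorem sub_two_pow_mul_mem_pow {A : Type*} [CommRing A] (ψ : A →+* A) (m : Ideal A)
    (hψ : ∀ f ∈ m, ψ f - 2 * f ∈ m ^ 2) {n : ℕ} (hn : 1 ≤ n) {f : A} (hf : f ∈ m ^ n) :
    ψ f - 2 ^ n * f ∈ m ^ (n + 1) := by
  induction n, hn using Nat.le_induction generalizing f with
  | base => simpa using hψ f (by simpa using hf)
  | succ n hn ih =>
    rw [pow_succ] at hf
    induction hf using Submodule.mul_induction_on' with
    | mem_mul_mem a ha b hb =>
      have h1 := ih ha
      have h2 := hψ b hb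
      have h3 : ψ (a * b) - 2 ^ (n + 1) * (a * b) =
          (ψ a - 2 ^ n * a) * (ψ b - 2 * b) + (ψ a - 2 ^ n * a) * (2 * b) +
            2 ^ n * a * (ψ b - 2 * b) := by
        rw [map_mul]
        ring
      rw [h3]
      refine add_mem (add_mem ?_ ?_) ?_
      · have := Ideal.mul_mem_mul h1 h2
        rw [← pow_add] at this
        exact Ideal.pow_le_pow_right (by omega) this
      · rw [pow_succ]
        exact Ideal.mul_mem_mul h1 (Ideal.mul_mem_left _ _ hb)
      · rw [add_assoc, pow_add]
        exact Ideal.mul_mem_mul (Ideal.mul_mem_left _ _ ha) h2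
    | add x hx y hy h1 h2 =>
      have : ψ (x + y) - 2 ^ (n + 1) * (x + y) =
        (ψ x - 2 ^ (n + 1) * x) + (ψ y - 2 ^ (n + 1) * y) := by rw [map_add]; ring
      rw [this]
      exact add_mem h1 h2

/-- If `ψ` squares `1 + u` modulo `J` and acts by doubling on `m / m ^ 2`, and `u` vanishes to second order,
then `u` vanishes to infinite order. -/
theorem mem_pow_sup_of_mem_sq_sup {k : Type*} [Field k] [CharZero k] {A : Type*} [CommRing A]
    [Algebra k A] (ψ : A →+* A) (m J : Ideal A) (hψ : ∀ f ∈ m, ψ f - 2 * f ∈ m ^ 2)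
    (hJ : ∀ f ∈ J, ψ f ∈ J) {u : A} (hu : ψ u - (2 * u + u ^ 2) ∈ J) (h : u ∈ m ^ 2 ⊔ J) (n : ℕ) :
    u ∈ m ^ n ⊔ J := by
  -- The exponent must start at 2: the argument divides by 2^N - 2, which vanishes for N = 1.
  have key (n : ℕ) : u ∈ m ^ (n + 2) ⊔ J := by
    induction n with
    | zero => exact h
    | succ n ih =>
      obtain ⟨a, ha, j, hj, hu'⟩ := Submodule.mem_sup.mp ih
      have h1 := sub_two_pow_mul_mem_pow ψ m hψ (by omega : 1 ≤ n + 2) ha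
      have h2 : a ^ 2 ∈ m ^ (n + 2 + 1) := by
        have := Ideal.pow_mem_pow ha 2
        rw [← pow_mul] at this
        exact Ideal.pow_le_pow_right (by omega) this
      have hc : (2 ^ (n + 2) - 2 : k) ≠ 0 := by
        have h3 : (2 : ℕ) ^ (n + 2) ≠ 2 := by
          rw [pow_succ]
          have := Nat.one_lt_two_pow (n := n + 1) (by omega)
          omega
        rw [sub_ne_zero]
        exact_mod_cast h3
      have h4 : (2 ^ (n + 2) - 2) * a ∈ m ^ (n + 2 + 1) ⊔ J := by
        -- Substitute u = a + j in ψ(u) ≡ 2u + u² and compare leading terms, ψ(a) ≡ 2^(n+2) a.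
        have h5 : (2 ^ (n + 2) - 2) * a = (a ^ 2 - (ψ a - 2 ^ (n + 2) * a)) +
            ((ψ u - (2 * u + u ^ 2)) - ψ j + (2 + 2 * a + j) * j) := by
          rw [← hu', map_add]
          ring
        rw [h5]
        exact Submodule.add_mem_sup (sub_mem h2 h1)
          (add_mem (sub_mem hu (hJ j hj)) (Ideal.mul_mem_left _ _ hj))
      have h6 : a ∈ m ^ (n + 2 + 1) ⊔ J := by
        have h7 := Ideal.mul_mem_left _ (algebraMap k A (2 ^ (n + 2) - 2)⁻¹) h4
        have h8 : (2 ^ (n + 2) - 2 : A) = algebraMap k A (2 ^ (n + 2) - 2) := by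
          rw [map_sub, map_pow, map_ofNat]
        rwa [h8, ← mul_assoc, ← map_mul, inv_mul_cancel₀ hc, map_one, one_mul] at h7
      rw [← hu']
      exact add_mem h6 (Ideal.mem_sup_right hj)
  exact sup_le_sup_right (Ideal.pow_le_pow_right (by omega)) J (key n)

/-- A form of Krull's intersection theorem. -/
theorem exists_mul_sub_mem_of_forall_mem_pow_sup {A : Type*} [CommRing A] [IsNoetherianRing A]
    (m J : Ideal A) {u : A} (h : ∀ n, u ∈ m ^ n ⊔ J) : ∃ a ∈ m, a * u - u ∈ J := by
  have h1 : Ideal.Quotient.mk J u ∈ (⨅ i : ℕ, m ^ i • ⊤ : Submodule A (A ⧸ J)) := by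
    rw [Submodule.mem_iInf]
    intro n
    obtain ⟨a, ha, j, hj, rfl⟩ := Submodule.mem_sup.mp (h n)
    rw [map_add, Ideal.Quotient.eq_zero_iff_mem.mpr hj, add_zero]
    have := Submodule.smul_mem_smul ha (Submodule.mem_top : (1 : A ⧸ J) ∈ ⊤)
    rwa [Algebra.smul_def, mul_one] at this
  obtain ⟨⟨a, ha⟩, h2⟩ := (Ideal.mem_iInf_smul_pow_eq_bot_iff m _).mp h1
  refine ⟨a, ha, ?_⟩
  rw [← Ideal.Quotient.eq_zero_iff_mem, map_sub, map_mul, sub_eq_zero]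
  rwa [Algebra.smul_def] at h2

variable {k : Type*} [Field k] {A : Type*} [CommRing A] [HopfAlgebra k A]

variable (k A) in
/-- The comorphism of `g ↦ g * g`. -/
def squaring : A →ₐ[k] A := (toConv (AlgHom.id k A) * toConv (AlgHom.id k A)).ofConv

theorem point_squaring (g : Points k A) (f : A) :
    g.ofConv (squaring k A f) = (g * g).ofConv f := by
  rw [← AlgHom.comp_apply, squaring, AlgHom.comp_convMul_distrib]
  simp

/-- The comorphism of `h ↦ g * h`. -/
def leftTranslation (g : Points k A) : A →ₐ[k] A :=
  (toConv ((Algebra.ofId k A).comp g.ofConv) * toConv (AlgHom.id k A)).ofConv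

theorem point_leftTranslation (g h : Points k A) (f : A) :
    h.ofConv (leftTranslation g f) = (g * h).ofConv f := by
  rw [← AlgHom.comp_apply, leftTranslation, AlgHom.comp_convMul_distrib]
  have : toConv (h.ofConv.comp ((Algebra.ofId k A).comp g.ofConv)) = g := by
    ext; simp [Algebra.ofId_apply]
  simp only [this]
  simp

/-- For f ∈ m, Δf ≡ f ⊗ 1 + 1 ⊗ f modulo m ⊗ m; multiplying the two tensor factors gives 2f modulo
m². -/
theorem squaring_sub_two_mul_mem {f : A}
    (hf : f ∈ RingHom.ker (Bialgebra.counitAlgHom k A)) :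
    squaring k A f - 2 * f ∈ RingHom.ker (Bialgebra.counitAlgHom k A) ^ 2 := by
  let r := Coalgebra.Repr.arbitrary k f
  let ε : A → A := fun x => algebraMap k A (Coalgebra.counit (R := k) x)
  have h0 : ε f = 0 := by
    have : Coalgebra.counit (R := k) f = 0 := hf
    simp [ε, this]
  have h1 : squaring k A f = ∑ i ∈ r.index, r.left i * r.right i := by
    change (toConv (AlgHom.id k A) * toConv (AlgHom.id k A)) f = _
    rw [AlgHom.convMul_apply, ← r.eq, map_sum]
    simp
  have h2 : ∑ i ∈ r.index, ε (r.left i) * r.right i = f := by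
    have := Coalgebra.sum_counit_smul r
    simpa [ε, Algebra.smul_def] using this
  have h3 : ∑ i ∈ r.index, r.left i * ε (r.right i) = f := by
    have h : (toConv LinearMap.id * 1 : WithConv (A →ₗ[k] A)) f = f := by rw [mul_one]; rfl
    rwa [r.convMul_apply] at h
  have h4 : ∑ i ∈ r.index, ε (r.left i) * ε (r.right i) = 0 := by
    have := congrArg ε h2
    rw [h0] at this
    rw [← this]
    simp [ε]
  have h5 : squaring k A f - 2 * f =
      ∑ i ∈ r.index, (r.left i - ε (r.left i)) * (r.right i - ε (r.right i)) := by
    simp only [sub_mul, mul_sub, Finset.sum_sub_distrib, h2, h3, h4, ← h1]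
    ring
  have h6 (x : A) : x - ε x ∈ RingHom.ker (Bialgebra.counitAlgHom k A) := by
    rw [RingHom.mem_ker, map_sub, sub_eq_zero]
    simp [ε]
  rw [h5, pow_two]
  exact sum_mem fun i _ => Ideal.mul_mem_mul (h6 _) (h6 _)

end Augmentation

/-! ### Conical orbits -/

section Conical

open WithConv

variable {k : Type*} [Field k] {A : Type*} [CommRing A] [HopfAlgebra k A]

theorem exists_apply_eq_one {V : Type*} [AddCommGroup V] [Module k V] {α : Module.Dual k V}
    (hα : α ≠ 0) : ∃ v, α v = 1 := by
  obtain ⟨v, hv⟩ : ∃ v, α v ≠ 0 := by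
    by_contra! h
    exact hα (LinearMap.ext h)
  exact ⟨(α v)⁻¹ • v, by rw [map_smul, smul_eq_mul, inv_mul_cancel₀ hv]⟩

/-- If a regular function `c` restricts to a character of a subgroup `Γ` and `c - 1` vanishes to
second order at the identity on the closure of `Γ`, then `c` takes finitely many values on `Γ`. -/
theorem finite_image_of_mem_sq_sup [CharZero k] [IsNoetherianRing A] (Γ : Subgroup (Points k A))
    (c : A) (hc : ∀ g ∈ Γ, ∀ h ∈ Γ, (g * h).ofConv c = g.ofConv c * h.ofConv c)
    (J : Ideal A) (hJ : ∀ f, f ∈ J ↔ ∀ g ∈ Γ, g.ofConv f = 0)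
    (hu : c - 1 ∈ RingHom.ker (Bialgebra.counitAlgHom k A) ^ 2 ⊔ J) :
    ((fun g : Points k A => g.ofConv c) '' Γ).Finite := by
  obtain ⟨a, ha, hau⟩ := exists_mul_sub_mem_of_forall_mem_pow_sup _ J
    (mem_pow_sup_of_mem_sq_sup (k := k) (squaring k A : A →+* A) _ J
      (fun f hf => squaring_sub_two_mul_mem hf)
      (fun f hf => (hJ _).mpr fun g hg => by
        have := (hJ f).mp hf _ (Γ.mul_mem hg hg)
        rwa [← point_squaring] at this)
      ((hJ _).mpr fun g hg => by
        have h1 := hc g hg g hg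
        rw [← point_squaring] at h1
        simp only [RingHom.coe_coe, map_sub, map_add, map_mul, map_pow, map_one, h1, map_ofNat]
        ring) hu)
  classical
  -- Quasi-compactness of Γ: the loci where the translates of 1 - a do not vanish cover Γ, since 1 -
  -- a is 1 at the identity, and by noetherianity finitely many translates suffice.
  obtain ⟨t, ht, hspan⟩ := Submodule.fg_span_iff_fg_span_finset_subset
    ((fun g : Points k A => leftTranslation g⁻¹ (1 - a)) '' Γ) |>.mp
      (IsNoetherian.noetherian (R := A) (M := A) _)
  obtain ⟨s, hs, rfl⟩ := Finset.subset_set_image_iff.mp ht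
  refine (s.finite_toSet.image fun g : Points k A => g.ofConv c).subset ?_
  rintro _ ⟨h, hh, rfl⟩
  obtain ⟨g, hg, hgh⟩ : ∃ g ∈ s, h.ofConv (leftTranslation g⁻¹ (1 - a)) ≠ 0 := by
    by_contra! hcon
    have h1 : Submodule.span A ((fun g : Points k A => leftTranslation g⁻¹ (1 - a)) '' Γ) ≤
        RingHom.ker h.ofConv := by
      rw [hspan, Submodule.span_le]
      intro f hf
      obtain ⟨g, hg, rfl⟩ := Finset.mem_image.mp hf
      exact hcon g hg
    have h2 := h1 (Submodule.subset_span ⟨h, hh, rfl⟩)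
    rw [RingHom.mem_ker, point_leftTranslation, inv_mul_cancel, map_sub, map_one] at h2
    have h3 : (1 : Points k A).ofConv a = 0 := ha
    simp [h3] at h2
  have hgΓ := hs hg
  rw [point_leftTranslation, map_sub, map_one] at hgh
  have h1 := (hJ _).mp hau (g⁻¹ * h) (Γ.mul_mem (Γ.inv_mem hgΓ) hh)
  -- (1 - a)(c - 1) vanishes on Γ and the first factor is nonzero at g⁻¹h, so c(g⁻¹h) = 1 and c(h) =
  -- c(g).
  have h2 : (1 - (g⁻¹ * h).ofConv a) * ((g⁻¹ * h).ofConv c - 1) = 0 := by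
    simp only [map_sub, map_mul, map_one] at h1
    linear_combination -h1
  have h3 := hc g hgΓ (g⁻¹ * h) (Γ.mul_mem (Γ.inv_mem hgΓ) hh)
  rw [mul_inv_cancel_left, sub_eq_zero.mp ((mul_eq_zero.mp h2).resolve_left hgh), mul_one] at h3
  exact ⟨g, hg, h3.symm⟩

/-- Only k-points are used, through the ideal of functions vanishing on Γ, so k need not be
algebraically closed here. -/
theorem exists_lie_eq_of_forall_exists_Ad_eq [CharZero k] [Algebra.FiniteType k A]
    [FiniteDimensional k (lieAlg k A)] (α : Module.Dual k (lieAlg k A))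
    (hα : ∀ t : k, t ≠ 0 → ∃ g : Points k A, ∀ D, α (Ad k A g D) = t * α D) :
    ∃ E : lieAlg k A, ∀ D, α ⁅E, D⁆ = α D := by
  have : IsNoetherianRing A := Algebra.FiniteType.isNoetherianRing k A
  by_cases h0 : α = 0
  · exact ⟨0, by simp [h0]⟩
  obtain ⟨v, hv⟩ := exists_apply_eq_one h0
  obtain ⟨a, ha⟩ := exists_dual_eq_counit α
  have hcoeff (g : Points k A) (D : lieAlg k A) :
      g.ofConv (adCoeff D.1 a) = α (Ad k A g D) := by
    rw [ha, point_adCoeff]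
    rfl
  set c := adCoeff v.1 a with hc
  have hmul (g h : Points k A) (D : lieAlg k A) : Ad k A (g * h) D = Ad k A g (Ad k A h D) := by
    rw [map_mul]
    rfl
  have hinv (g : Points k A) (D : lieAlg k A) : Ad k A g (Ad k A g⁻¹ D) = D := by
    rw [← hmul, mul_inv_cancel, map_one]
    rfl
  let Γ : Subgroup (Points k A) :=
    { carrier := {g | ∀ D, α (Ad k A g D) = g.ofConv c * α D}
      one_mem' := fun D => by
        rw [hc, hcoeff, map_one]
        simp [hv]
      mul_mem' := fun {g h} hg hh D => by
        have h1 (D) : α (Ad k A (g * h) D) = g.ofConv c * h.ofConv c * α D := by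
          rw [hmul, hg, hh, mul_assoc]
        rw [h1, hc, hcoeff (g * h) v, h1, hv, mul_one]
      inv_mem' := fun {g} hg D => by
        have h1 (D) : g.ofConv c * α (Ad k A g⁻¹ D) = α D := by rw [← hg, hinv]
        have h2 : g.ofConv c * (g⁻¹).ofConv c = 1 := by
          rw [hc, hcoeff g⁻¹ v, ← hc, h1, hv]
        rw [← h1 D, ← mul_assoc, mul_comm _ (g.ofConv c), h2, one_mul] }
  have hΓ {g : Points k A} (hg : g ∈ Γ) (D : lieAlg k A) :
      α (Ad k A g D) = g.ofConv c * α D := hg D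
  let J : Ideal A := ⨅ g ∈ Γ, RingHom.ker g.ofConv
  have hJ (f : A) : f ∈ J ↔ ∀ g ∈ Γ, g.ofConv f = 0 := by
    simp only [J, Submodule.mem_iInf, RingHom.mem_ker]
  by_cases hu : c - 1 ∈ RingHom.ker (Bialgebra.counitAlgHom k A) ^ 2 ⊔ J
  · exfalso
    have hfin := finite_image_of_mem_sq_sup Γ c (fun g hg h hh => by
      rw [hc, hcoeff (g * h) v, hmul, hΓ hg, hΓ hh, hv, mul_one]) J hJ hu
    refine Set.infinite_univ (α := k) ((hfin.insert 0).subset fun t _ => ?_)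
    by_cases ht : t = 0
    · exact Or.inl ht
    obtain ⟨g, hg⟩ := hα t ht
    have h1 : g.ofConv c = t := by rw [hc, hcoeff, hg, hv, mul_one]
    exact Or.inr ⟨g, fun D => by rw [hg, h1], h1⟩
  · have hmem (f : A) : f - algebraMap k A (Coalgebra.counit (R := k) f) ∈
        RingHom.ker (Bialgebra.counitAlgHom k A) := by
      rw [RingHom.mem_ker, map_sub, sub_eq_zero]
      simp
    obtain ⟨δ₀, hδu, hδ⟩ := Submodule.exists_le_ker_of_notMem
      (p := Submodule.restrictScalars k (RingHom.ker (Bialgebra.counitAlgHom k A) ^ 2 ⊔ J)) hu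
    have hδ' {f : A} (hf : f ∈ RingHom.ker (Bialgebra.counitAlgHom k A) ^ 2 ⊔ J) :
        δ₀ f = 0 := hδ hf
    -- Subtracting the constant term makes δ kill scalars; as δ₀ kills m², δ is a point derivation
    -- at the identity.
    let δ : A →ₗ[k] k := δ₀ ∘ₗ (LinearMap.id - Algebra.linearMap k A ∘ₗ Coalgebra.counit)
    have hδdef (f : A) : δ f = δ₀ (f - algebraMap k A (Coalgebra.counit (R := k) f)) := rfl
    obtain ⟨E, hE, hEδ⟩ := exists_mem_lieAlg_counit_eq δ (fun f g => by
      have h1 : f * g - algebraMap k A (Coalgebra.counit (R := k) (f * g)) =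
          (f - algebraMap k A (Coalgebra.counit (R := k) f)) *
            (g - algebraMap k A (Coalgebra.counit (R := k) g)) +
          (Coalgebra.counit (R := k) f • (g - algebraMap k A (Coalgebra.counit (R := k) g)) +
          Coalgebra.counit (R := k) g • (f - algebraMap k A (Coalgebra.counit (R := k) f))) := by
        simp only [Algebra.smul_def, Bialgebra.counit_mul, map_mul]
        ring
      have h2 := Ideal.mul_mem_mul (hmem f) (hmem g)
      rw [← pow_two] at h2
      rw [hδdef, h1, map_add, hδ' (Ideal.mem_sup_left h2), zero_add, map_add, map_smul, map_smul]
      rfl)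
    have hcounit {f : A} (hf : f ∈ J) : Coalgebra.counit (R := k) f = 0 :=
      (hJ f).mp hf 1 Γ.one_mem
    have hδJ {f : A} (hf : f ∈ J) : δ f = 0 := by
      rw [hδdef, hcounit hf, map_zero, sub_zero]
      exact hδ' (Ideal.mem_sup_right hf)
    have hc1 : Coalgebra.counit (R := k) c = 1 := by rw [hc, counit_adCoeff, ← ha, hv]
    have hδc : δ c ≠ 0 := by
      rw [hδdef, hc1, map_one]
      exact hδu
    have key (D : lieAlg k A) : α ⁅(⟨E, hE⟩ : lieAlg k A), D⁆ = δ c * α D := by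
      -- On Γ the function f_D equals α(D)c; applying δ turns this into α([E, D]) = δ(c) α(D).
      have h1 : adCoeff D.1 a - α D • c ∈ J := by
        rw [hJ]
        intro g hg
        rw [map_sub, map_smul, hcoeff, hΓ hg, smul_eq_mul, mul_comm, sub_self]
      have h2 := hδJ h1
      rw [map_sub, map_smul, sub_eq_zero, ← hEδ, apply_adCoeff hE, counit_adCoeff] at h2
      rw [ha, mul_comm]
      exact h2
    refine ⟨(δ c)⁻¹ • ⟨E, hE⟩, fun D => ?_⟩
    rw [smul_lie, map_smul, key, smul_eq_mul, inv_mul_cancel_left₀ hδc]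

/-- Over an algebraically closed field, every proper ideal has a rational point. -/
theorem exists_algHom_of_ne_top [IsAlgClosed k] {B : Type*} [CommRing B] [Algebra k B]
    [Algebra.FiniteType k B] (I : Ideal B) (hI : I ≠ ⊤) :
    ∃ g : B →ₐ[k] k, ∀ f ∈ I, g f = 0 := by
  obtain ⟨M, hM, hIM⟩ := Ideal.exists_le_maximal I hI
  let := Ideal.Quotient.field M
  have := finite_of_finite_type_of_isJacobsonRing k (B ⧸ M)
  let e : k ≃ₐ[k] B ⧸ M := AlgEquiv.ofBijective (Algebra.ofId k (B ⧸ M))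
    IsAlgClosed.algebraMap_bijective_of_isIntegral
  refine ⟨(e.symm : (B ⧸ M) →ₐ[k] k).comp (Ideal.Quotient.mkₐ k M), fun f hf => ?_⟩
  have : Ideal.Quotient.mkₐ k M f = 0 := Ideal.Quotient.eq_zero_iff_mem.mpr (hIM hf)
  rw [AlgHom.comp_apply, this, map_zero]

/-- A regular function satisfying no polynomial equation takes all but finitely many values. -/
theorem exists_polynomial_forall_exists_algHom [IsAlgClosed k] {B : Type*} [CommRing B]
    [Algebra k B] [Algebra.FiniteType k B] (c : B)
    (hc : Function.Injective (Polynomial.aeval (R := k) c)) :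
    ∃ f : Polynomial k, f ≠ 0 ∧ ∀ s, f.eval s ≠ 0 → ∃ g : B →ₐ[k] k, g c = s := by
  let φ : Polynomial k →+* B := (Polynomial.aeval (R := k) c : Polynomial k →+* B)
  have hfin : φ.FinitePresentation := by
    rw [← RingHom.FinitePresentation.of_finiteType]
    refine RingHom.FiniteType.of_comp_finiteType (f := algebraMap k (Polynomial k)) ?_
    have : φ.comp (algebraMap k (Polynomial k)) = algebraMap k B :=
      (Polynomial.aeval (R := k) c).comp_algebraMap
    rw [this]
    exact RingHom.finiteType_algebraMap.mpr inferInstance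
  obtain ⟨S, hS⟩ := PrimeSpectrum.exists_constructibleSetData_iff.mpr
    (PrimeSpectrum.isConstructible_range_comap hfin)
  -- Injectivity puts the generic point of the line in the image, so some constructible piece
  -- contains it. That piece has no nontrivial closed condition and is the open set where `C.f` is
  -- nonzero.
  obtain ⟨p, hp, hpφ⟩ := Ideal.exists_comap_eq_of_mem_minimalPrimes_of_injective (f := φ) hc ⊥
    (by rw [IsDomain.minimalPrimes_eq_singleton_bot]; rfl)
  have hbot : (⊥ : PrimeSpectrum (Polynomial k)) ∈ S.toSet := by
    rw [hS]
    exact ⟨⟨p, hp⟩, PrimeSpectrum.ext hpφ⟩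
  simp only [PrimeSpectrum.ConstructibleSetData.toSet, Set.mem_iUnion] at hbot
  obtain ⟨C, hC, hbot⟩ := hbot
  obtain ⟨hg, hf⟩ := hbot
  refine ⟨C.f, fun h0 => hf ?_, fun s hs => ?_⟩
  · simp [h0]
  let P : PrimeSpectrum (Polynomial k) :=
    ⟨RingHom.ker (Polynomial.evalRingHom s), RingHom.ker_isPrime _⟩
  have hP : P ∈ Set.range (PrimeSpectrum.comap φ) := by
    rw [← hS]
    simp only [PrimeSpectrum.ConstructibleSetData.toSet, Set.mem_iUnion]
    refine ⟨C, hC, ?_, ?_⟩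
    · rw [PrimeSpectrum.mem_zeroLocus] at hg ⊢
      intro x hx
      have : x = 0 := hg hx
      rw [this]
      exact zero_mem _
    · rw [PrimeSpectrum.mem_zeroLocus, Set.singleton_subset_iff]
      exact hs
  obtain ⟨Q, hQ⟩ := hP
  obtain ⟨g, hg⟩ := exists_algHom_of_ne_top (k := k) Q.asIdeal Q.isPrime.ne_top
  refine ⟨g, ?_⟩
  have h1 : Polynomial.X - Polynomial.C s ∈ P.asIdeal := by
    change Polynomial.X - Polynomial.C s ∈ RingHom.ker (Polynomial.evalRingHom s)
    simp [RingHom.mem_ker]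
  rw [← hQ] at h1
  have h2 := hg _ h1
  simpa [φ, sub_eq_zero] using h2

/-- An ideal of polynomials stable under the Euler operator contains a monomial. -/
theorem exists_X_pow_mem [CharZero k] (P : Ideal (Polynomial k))
    (hP : ∀ p ∈ P, Polynomial.X * Polynomial.derivative p ∈ P) {p : Polynomial k} (hp : p ∈ P)
    (hp0 : p ≠ 0) : ∃ n, Polynomial.X ^ n ∈ P := by
  induction hn : p.support.card using Nat.strong_induction_on generalizing p with
  | _ n ih =>
    let d := p.natDegree
    -- The coefficient of X^i is multiplied by i - d, so the leading term disappears and the support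
    -- shrinks, unless p was already a monomial.
    let r := Polynomial.X * Polynomial.derivative p - Polynomial.C (d : k) * p
    have hr : r ∈ P := sub_mem (hP p hp) (P.mul_mem_left _ hp)
    have hcoeff (i : ℕ) : r.coeff i = ((i : k) - d) * p.coeff i := by
      cases i with
      | zero => simp [r]
      | succ i =>
        simp only [r, Polynomial.coeff_sub, Polynomial.coeff_X_mul, Polynomial.coeff_derivative,
          Polynomial.coeff_C_mul]
        push_cast
        ring
    by_cases hr0 : r = 0
    · have h1 : p = Polynomial.C p.leadingCoeff * Polynomial.X ^ d := by
        ext i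
        rw [Polynomial.coeff_C_mul_X_pow]
        split_ifs with hi
        · rw [hi]; rfl
        · have h2 := hcoeff i
          rw [hr0, Polynomial.coeff_zero, eq_comm, mul_eq_zero, sub_eq_zero] at h2
          exact h2.resolve_left fun h3 => hi (Nat.cast_injective h3)
      have h3 := P.mul_mem_left (Polynomial.C p.leadingCoeff⁻¹) hp
      rw [h1, ← mul_assoc, ← Polynomial.C_mul] at h3
      simp [hp0] at h3
      exact ⟨d, h3⟩
    · refine ih _ ?_ hr hr0 rfl
      rw [← hn]
      refine Finset.card_lt_card (Finset.ssubset_iff_of_subset (fun i hi => ?_) |>.mpr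
        ⟨d, ?_, ?_⟩)
      · rw [Polynomial.mem_support_iff, hcoeff] at hi
        exact Polynomial.mem_support_iff.mpr (right_ne_zero_of_mul hi)
      · exact Polynomial.natDegree_mem_support_of_nonzero hp0
      · rw [Polynomial.mem_support_iff, hcoeff, sub_self, zero_mul, not_not]

theorem exists_Ad_eq_of_lie_eq [CharZero k] [IsAlgClosed k] [Algebra.FiniteType k A]
    [FiniteDimensional k (lieAlg k A)] (α : Module.Dual k (lieAlg k A)) (E : lieAlg k A)
    (hE : ∀ D, α ⁅E, D⁆ = α D) (t : k) (ht : t ≠ 0) :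
    ∃ g : Points k A, ∀ D, α (Ad k A g D) = t * α D := by
  by_cases h0 : α = 0
  · exact ⟨1, by simp [h0]⟩
  obtain ⟨v, hv⟩ := exists_apply_eq_one h0
  obtain ⟨a, ha⟩ := exists_dual_eq_counit α
  have hcoeff (g : Points k A) (D : lieAlg k A) :
      g.ofConv (adCoeff D.1 a) = α (Ad k A g D) := by
    rw [ha, point_adCoeff]
    rfl
  set c := adCoeff v.1 a with hc
  let J : Ideal A := Ideal.span (Set.range fun D : lieAlg k A => adCoeff D.1 a - α D • c)
  have hgen (D : lieAlg k A) : adCoeff D.1 a - α D • c ∈ J := Ideal.subset_span ⟨D, rfl⟩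
  have hEcoeff (D : lieAlg k A) : E.1 (adCoeff D.1 a) = adCoeff (⁅E, D⁆ : lieAlg k A).1 a :=
    apply_adCoeff E.2 _ _
  have hEc : E.1 c - c ∈ J := by
    have := hgen ⁅E, v⁆
    rwa [hE, hv, one_smul, ← hEcoeff] at this
  have hEJ {f : A} (hf : f ∈ J) : E.1 f ∈ J := by
    induction hf using Submodule.span_induction with
    | mem x hx =>
      obtain ⟨D, rfl⟩ := hx
      have h1 := hgen ⁅E, D⁆
      rw [hE, ← hEcoeff] at h1
      have h2 : E.1 (adCoeff D.1 a - α D • c) =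
          (E.1 (adCoeff D.1 a) - α D • c) - α D • (E.1 c - c) := by
        rw [map_sub, Derivation.map_smul, smul_sub]
        abel
      rw [h2]
      exact sub_mem h1 (Submodule.smul_of_tower_mem J _ hEc)
    | zero => simp
    | add x y hx hy h1 h2 => rw [map_add]; exact add_mem h1 h2
    | smul b x hx h1 =>
      rw [smul_eq_mul, Derivation.leibniz]
      exact add_mem (J.mul_mem_left _ h1) (J.mul_mem_right _ hx)
  have hcounit {f : A} (hf : f ∈ J) : Bialgebra.counitAlgHom k A f = 0 := by
    have h1 : J ≤ RingHom.ker (Bialgebra.counitAlgHom k A) := by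
      refine Ideal.span_le.mpr ?_
      rintro _ ⟨D, rfl⟩
      change Coalgebra.counit (R := k) (adCoeff D.1 a - α D • c) = 0
      rw [map_sub, map_smul, hc, counit_adCoeff, counit_adCoeff, ← ha, ← ha, hv, smul_eq_mul,
        mul_one, sub_self]
    exact h1 hf
  have hinj : Function.Injective (Polynomial.aeval (R := k) (Ideal.Quotient.mk J c)) := by
    rw [injective_iff_map_eq_zero]
    intro p hp
    by_contra hp0
    have haeval (p : Polynomial k) : Polynomial.aeval (Ideal.Quotient.mk J c) p =
        Ideal.Quotient.mk J (Polynomial.aeval c p) :=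
      Polynomial.aeval_algHom_apply (Ideal.Quotient.mkₐ k J) c p
    have hker (p : Polynomial k) :
        p ∈ RingHom.ker (Polynomial.aeval (R := k) (Ideal.Quotient.mk J c)) ↔
          Polynomial.aeval c p ∈ J := by
      rw [RingHom.mem_ker, haeval, Ideal.Quotient.eq_zero_iff_mem]
    obtain ⟨n, hn⟩ := exists_X_pow_mem
      (RingHom.ker (Polynomial.aeval (R := k) (Ideal.Quotient.mk J c))) (fun p hp => by
        rw [hker] at hp ⊢
        -- E(p(c)) = p'(c) E(c) ≡ c p'(c) modulo J, so the relations satisfied by c are stable under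
        -- the Euler operator. A relation c^n ∈ J would contradict ε(c) = 1, since ε kills J.
        have h1 := hEJ hp
        rw [Derivation.map_aeval, smul_eq_mul] at h1
        have h2 := J.mul_mem_left (Polynomial.aeval c (Polynomial.derivative p)) hEc
        rw [map_mul, Polynomial.aeval_X]
        have h3 := sub_mem h1 h2
        rwa [mul_sub, sub_sub_cancel, mul_comm] at h3) hp hp0
    rw [hker] at hn
    have h1 := hcounit hn
    have hc1 : Bialgebra.counitAlgHom k A c = 1 := by
      change Coalgebra.counit (R := k) c = 1
      rw [hc, counit_adCoeff, ← ha, hv]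
    rw [map_pow, Polynomial.aeval_X, map_pow, hc1, one_pow] at h1
    exact one_ne_zero h1
  obtain ⟨f, hf0, hf⟩ := exists_polynomial_forall_exists_algHom _ hinj
  have hpoint (s : k) (hs : f.eval s ≠ 0) : ∃ g : Points k A, ∀ D, α (Ad k A g D) = s * α D := by
    obtain ⟨g, hg⟩ := hf s hs
    refine ⟨toConv (g.comp (Ideal.Quotient.mkₐ k J)), fun D => ?_⟩
    have h1 : g (Ideal.Quotient.mk J (adCoeff D.1 a - α D • c)) = 0 := by
      rw [Ideal.Quotient.eq_zero_iff_mem.mpr (hgen D), map_zero]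
    rw [map_sub, map_sub, sub_eq_zero] at h1
    rw [← hcoeff]
    change g (Ideal.Quotient.mk J (adCoeff D.1 a)) = _
    rw [h1, ← hg, mul_comm]
    exact map_smul (g.comp (Ideal.Quotient.mkₐ k J)) (α D) c
  have hcomp : f.comp (Polynomial.C t * Polynomial.X) ≠ 0 := by
    rw [Ne, Polynomial.comp_eq_zero_iff]
    rintro (h | ⟨_, h⟩)
    · exact hf0 h
    · have := congrArg (fun p => Polynomial.coeff p 1) h
      simp [Polynomial.coeff_C, ht] at this
  -- Choose s ≠ 0 with both s and ts attained as scaling factors; t is then their quotient.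
  obtain ⟨s, hs⟩ := Polynomial.exists_eval_ne_zero_of_natDegree_lt_card
    (Polynomial.X * f * f.comp (Polynomial.C t * Polynomial.X))
    (mul_ne_zero (mul_ne_zero Polynomial.X_ne_zero hf0) hcomp)
    (Cardinal.natCast_lt_aleph0.trans_le (Cardinal.aleph0_le_mk k))
  simp only [Polynomial.eval_mul, Polynomial.eval_X, Polynomial.eval_comp, Polynomial.eval_C] at hs
  obtain ⟨g, hg⟩ := hpoint s (right_ne_zero_of_mul (left_ne_zero_of_mul hs))
  obtain ⟨h, hh⟩ := hpoint (t * s) (right_ne_zero_of_mul hs)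
  refine ⟨h * g⁻¹, fun D => ?_⟩
  have h1 : s * α (Ad k A g⁻¹ D) = α D := by
    rw [← hg, ← Module.End.mul_apply, ← map_mul, mul_inv_cancel, map_one, Module.End.one_apply]
  rw [map_mul, Module.End.mul_apply, hh, mul_assoc, h1]

theorem isConicalOrbit_iff [CharZero k] [IsAlgClosed k] [Algebra.FiniteType k A]
    {q : Type*} [LieRing q] [LieAlgebra k q] [FiniteDimensional k q]
    (e : lieAlg k A ≃ₗ⁅k⁆ q) (α : Module.Dual k q) :
    IsConicalOrbit e α ↔ α ∈ adStar k α := by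
  have : FiniteDimensional k (lieAlg k A) := e.toLinearEquiv.symm.finiteDimensional
  let β : Module.Dual k (lieAlg k A) := α ∘ₗ (e : lieAlg k A →ₗ[k] q)
  have hβ (D : lieAlg k A) : β D = α (e D) := rfl
  have horbit (c : k) : c • α ∈ coadjointOrbit e α ↔
      ∃ g : Points k A, ∀ D, β (Ad k A g D) = c * β D := by
    constructor
    · rintro ⟨g, hg⟩
      -- The dual representation acts through Ad(g⁻¹), hence the inverse.
      refine ⟨g⁻¹, fun D => ?_⟩
      have h := LinearMap.congr_fun hg (e D)
      change β (Ad k A g⁻¹ (e.symm (e D))) = c * α (e D) at h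
      rwa [LieEquiv.symm_apply_apply] at h
    · rintro ⟨g, hg⟩
      refine ⟨g⁻¹, LinearMap.ext fun x => ?_⟩
      have h := hg (e.symm x)
      rw [hβ (e.symm x), LieEquiv.apply_symm_apply] at h
      change β (Ad k A g⁻¹⁻¹ (e.symm x)) = c * α x
      rwa [inv_inv]
  have hmem : α ∈ adStar k α ↔ ∃ E : lieAlg k A, ∀ D, β ⁅E, D⁆ = β D := by
    rw [mem_adStar]
    constructor
    · rintro ⟨x, hx⟩
      refine ⟨-e.symm x, fun D => ?_⟩
      rw [hβ D, hx, neg_lie, map_neg, hβ, LieEquiv.map_lie, LieEquiv.apply_symm_apply]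
    · rintro ⟨E, hE⟩
      refine ⟨-e E, fun y => ?_⟩
      have := hE (e.symm y)
      rw [hβ, hβ, LieEquiv.map_lie, LieEquiv.apply_symm_apply] at this
      rw [neg_lie, map_neg, neg_neg, this]
  rw [hmem]
  simp only [IsConicalOrbit, horbit]
  exact ⟨exists_lie_eq_of_forall_exists_Ad_eq β,
    fun ⟨E, hE⟩ c hc => exists_Ad_eq_of_lie_eq β E hE c hc⟩

end Conical
end ContactLie
end

theorem proposition2p1 {k : Type*} [Field k] [CharZero k]
    {q : Type*} [LieRing q] [LieAlgebra k q] [FiniteDimensional k q]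
    (hq : ContactLie.index k q = 1) :
    (ContactLie.IsContact k q ↔
      ContactLie.Generically k fun α : Module.Dual k q => α ∉ ContactLie.adStar k α) ∧
    ∀ (_ : IsAlgClosed k) (A : Type*) [CommRing A] [HopfAlgebra k A] [Algebra.FiniteType k A]
      (e : ContactLie.lieAlg k A ≃ₗ⁅k⁆ q),
      (ContactLie.Generically k (fun α : Module.Dual k q => α ∉ ContactLie.adStar k α) ↔
        ContactLie.Generically k fun α : Module.Dual k q => ¬ ContactLie.IsConicalOrbit e α) := by
  refine ⟨ContactLie.isContact_iff_generically hq, fun _ A _ _ _ e => ?_⟩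
  simp only [ContactLie.isConicalOrbit_iff]
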